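/- Let $a>2b>0$, let $d\ge 1$ be an integer, and let $F(u)=\frac a2\sin(2u)\left(\sin^2u-\frac ba\right)$. Consider the radial problem $$u''+\frac{d-1}{r}u'+F(u)=0\quad\text{on }(0,\infty),\qquad u'(0)=0 .$$ There is exactly one positive solution $Q$ on $[0,\infty)$ of this problem such that $(Q(r),Q'(r))\to(0,0)$ as $r\to\infty$. Furthermore, $Q$ is non-degenerate: the linearized problem $$v''+\frac{d-1}{r}v'+F'(Q)\,v=0\quad\text{on }(0,\infty),\qquad v(0)=1,\quad v'(0)=0$$ has exactly one solution $v$ on $[0,\infty)$, and $v$ diverges exponentially fast, that is, there are $C,\kappa>0$ such that $|v(r)|\ge Ce^{\kappa r}$ for all sufficiently large $r$. If moreover $d\ge2$, then $v(r)\to-\infty$ and $v'(r)\to-\infty$ exponentially fast as $r\to\infty$, that is, there are $C,\kappa>0$ such that $v(r)\le -Ce^{\kappa r}$ and $v'(r)\le -Ce^{\kappa r}$ for all sufficiently large $r$. Here a solution is a function that is $C^1$ on $[0,\infty)$ and twice differentiable on $(0,\infty)$ where it satisfies the equation. -/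

import Mathlib

open Set Filter Topology

noncomputable section

/-- The nonlinearity `F(u) = (a/2) sin(2u) (sin² u - b/a)`. -/
def nonlinF (a b : ℝ) (u : ℝ) : ℝ :=
  a / 2 * Real.sin (2 * u) * (Real.sin u ^ 2 - b / a)

/-- The derivative of a function on the half-line `[0, ∞)`: one-sided at `0`, the usual one at
every `r > 0`. -/
def radDeriv (u : ℝ → ℝ) : ℝ → ℝ := derivWithin u (Ici 0)

/-- `u` is a classical solution on `[0, ∞)` of `u'' + (d-1)/r u' + G(r, u) = 0`, `u'(0) = 0`:
it is `C¹` on `[0, ∞)`, its derivative vanishes at `0`, and it is twice differentiable and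
satisfies the equation at every `r > 0`. Only the values of `u` on `[0, ∞)` matter. -/
def SolvesRadialODE (d : ℕ) (G : ℝ → ℝ → ℝ) (u : ℝ → ℝ) : Prop :=
  DifferentiableOn ℝ u (Ici 0) ∧
  ContinuousOn (radDeriv u) (Ici 0) ∧
  radDeriv u 0 = 0 ∧
  ∀ r : ℝ, 0 < r →
    DifferentiableAt ℝ (radDeriv u) r ∧
    deriv (radDeriv u) r + ((d : ℝ) - 1) / r * radDeriv u r + G r (u r) = 0

/-- `u` is a positive solution of `u'' + (d-1)/r u' + F(u) = 0`, `u'(0) = 0`, such that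
`(u, u') → (0, 0)` at infinity. -/
def IsRadialGroundState (d : ℕ) (a b : ℝ) (u : ℝ → ℝ) : Prop :=
  SolvesRadialODE d (fun _ x => nonlinF a b x) u ∧
  (∀ r : ℝ, 0 ≤ r → 0 < u r) ∧
  Tendsto (fun r => (u r, radDeriv u r)) atTop (𝓝 (0, 0))

/-- `v` solves the linearized problem `v'' + (d-1)/r v' + F'(Q) v = 0`, `v(0) = 1`, `v'(0) = 0`
on `[0, ∞)`. -/
def IsLinearizedSolution (d : ℕ) (a b : ℝ) (Q v : ℝ → ℝ) : Prop :=
  SolvesRadialODE d (fun r x => deriv (nonlinF a b) (Q r) * x) v ∧ v 0 = 1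

/-- `f(r)` diverges (in absolute value) exponentially fast as `r → ∞`. -/
def DivergesExponentially (f : ℝ → ℝ) : Prop :=
  ∃ C : ℝ, 0 < C ∧ ∃ κ : ℝ, 0 < κ ∧ ∀ᶠ r in atTop, C * Real.exp (κ * r) ≤ |f r|

/-- `f(r) → -∞` exponentially fast as `r → ∞`. -/
def TendsToNegInftyExponentially (f : ℝ → ℝ) : Prop :=
  ∃ C : ℝ, 0 < C ∧ ∃ κ : ℝ, 0 < κ ∧ ∀ᶠ r in atTop, f r ≤ -(C * Real.exp (κ * r))

end

/-!
The proof is a shooting argument, with the initial value `y = u(0)` as parameter, for a general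
nonlinearity `F` with primitive `Φ` (`GroundStateNonlinearity`). The only delicate hypothesis is
that for every `l ≥ 1` the function `x F'(x) - l F(x)` changes sign once on `(0, B)`, from
positive to negative. For the sine nonlinearity (`nonlinF_sign_change`) let `α` be the zero of `F`
in `(0, π/2)`. Up to `α` one has `F ≤ 0` and `x F'(x) - F(x) > 0`; to the right of `α` the quotient
`x F'(x) / F(x)` is decreasing, which follows from
`sin² x - sin² α = sin (x - α) sin (x + α)` and the monotonicity of `z cot z`.

Non-degeneracy (`linearized_exponential`) uses McLeod's Wronskian method. Write `v` for the
linearized solution at a ground state `u`. In dimension at least two, comparison with `u'` shows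
that `v` has a zero (`exists_linearized_nonpos`). At its first zero `r1` choose `c > 0` such that
`f = r u' + c u` vanishes too. The Wronskian of `f` and `v` vanishes at `0` and at `r1`, and its
derivative is `v` times a multiple of `u F'(u) - (1 + 2/c) F(u)`, so by the sign condition this
factor is positive from `r1` on. Since `-r u' / u` is increasing there (`mul_deriv_add_neg`, by a
Pohozaev identity), `f < 0` after `r1`, which excludes a second zero of `v` and keeps the Wronskian
below a negative constant. A solution with this property diverges exponentially
(`exponential_of_wronskian`). In dimension one `f = u'` does the job, its Wronskian with `v` being
a negative constant.

Since `v` is the derivative of the solution with respect to `y`, its divergence to `-∞` shows that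
initial values just above that of a ground state give solutions crossing zero, and those just
below give solutions trapped at negative energy (`shooting_near_groundState`). Both behaviours are
open conditions and exclude each other, and every `y ∈ (0, B)` shows one of them or gives a ground
state (`shooting_trichotomy`). This forbids two ground states; one exists since `(0, B)` is
connected and both behaviours occur (`exists_crossing`, `exists_Φ_neg`).

The initial value problem is singular at `r = 0`. Existence comes from a contraction in a
Gaussian-weighted sup norm (`exists_radialSolution`); uniqueness and the dependence on the initial
value come from a Gronwall inequality for `z² + z'²` (`gronwall_radial`), in which the singular
damping has the good sign.
-/

/-! ### Hypotheses on the nonlinearity -/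

/-- The properties of a nonlinearity `F`, with derivative `F'` and primitive `Φ`, on which
existence, uniqueness and non-degeneracy of the ground state rest. The number `B` is the first
positive maximum point of the potential `Φ`, `L` bounds `F'` and `M` is a Lipschitz constant
of `F'`. -/
structure GroundStateNonlinearity (F F' Φ : ℝ → ℝ) (B L M : ℝ) : Prop where
  B_pos : 0 < B
  L_nonneg : 0 ≤ L
  M_nonneg : 0 ≤ M
  hasDerivAt_F : ∀ x, HasDerivAt F (F' x) x
  hasDerivAt_Φ : ∀ x, HasDerivAt Φ (F x) x
  F_zero : F 0 = 0
  Φ_zero : Φ 0 = 0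
  Φ_B_pos : 0 < Φ B
  Φ_le : ∀ x, Φ x ≤ Φ B
  abs_F'_le : ∀ x, |F' x| ≤ L
  abs_F'_sub_le : ∀ x y, |F' x - F' y| ≤ M * |x - y|
  F'_zero_neg : F' 0 < 0
  F_pos_of_Φ_nonneg : ∀ x, 0 < x → x < B → 0 ≤ Φ x → 0 < F x
  F_pos_of_lt : ∀ x x', 0 < x → x < x' → x' < B → 0 ≤ F x → 0 < F x'
  /-- For every `l ≥ 1` the function `x F'(x) - l F(x)` changes sign at most once on `(0, B)`,
  from positive to negative. -/
  sign_change : ∀ l x x', 1 ≤ l → 0 < x → x < x' → x' < B → x * F' x ≤ l * F x →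
    x' * F' x' < l * F x'

/-! ### Verification for the sine nonlinearity -/

section Trigonometry

/-- The derivative of `nonlinF`. -/
noncomputable def nonlinF' (a b u : ℝ) : ℝ :=
  a / 2 * (2 * Real.cos (2 * u)) * (Real.sin u ^ 2 - b / a) +
    a / 2 * Real.sin (2 * u) * (2 * Real.sin u * Real.cos u)

/-- The primitive of `nonlinF` vanishing at `0`. -/
noncomputable def potential (a b u : ℝ) : ℝ :=
  a / 4 * Real.sin u ^ 2 * (Real.sin u ^ 2 - 2 * (b / a))

lemma hasDerivAt_nonlinF (a b x : ℝ) : HasDerivAt (nonlinF a b) (nonlinF' a b x) x := by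
  have h1 : HasDerivAt (fun u : ℝ => Real.sin (2 * u)) (Real.cos (2 * x) * 2) x := by
    simpa using ((hasDerivAt_id x).const_mul 2).sin
  have h2 := (Real.hasDerivAt_sin x).pow 2
  have h := (h1.const_mul (a / 2)).mul (h2.sub_const (b / a))
  refine h.congr_deriv ?_
  simp only [nonlinF', Pi.pow_apply]
  push_cast
  ring

lemma hasDerivAt_potential (a b x : ℝ) : HasDerivAt (potential a b) (nonlinF a b x) x := by
  have h2 := (Real.hasDerivAt_sin x).pow 2
  have h := (h2.const_mul (a / 4)).mul (h2.sub_const (2 * (b / a)))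
  refine h.congr_deriv ?_
  simp only [nonlinF, Pi.pow_apply, Real.sin_two_mul]
  push_cast
  ring

lemma nonlinF'_eq (a b x : ℝ) : nonlinF' a b x =
    a / 2 * ((1 - 2 * (b / a)) * Real.cos (2 * x) - Real.cos (2 * (2 * x))) := by
  rw [nonlinF', Real.sin_two_mul, Real.cos_two_mul (2 * x), Real.cos_two_mul x]
  have h := Real.sin_sq_add_cos_sq x
  have h' : Real.sin x ^ 2 = 1 - Real.cos x ^ 2 := by linarith
  linear_combination (a * (2 * Real.cos x ^ 2 - 1 + 2 * Real.cos x ^ 2)) * h'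

lemma mul_cos_lt_sin {x : ℝ} (h0 : 0 < x) (h1 : x < Real.pi / 2) :
    x * Real.cos x < Real.sin x := by
  have hc := Real.cos_pos_of_mem_Ioo ⟨by linarith, h1⟩
  have h := Real.lt_tan h0 h1
  rw [Real.tan_eq_sin_div_cos, lt_div_iff₀ hc] at h
  exact h

lemma strictAntiOn_mul_cot :
    StrictAntiOn (fun z : ℝ => z * (Real.cos z / Real.sin z)) (Ioo 0 Real.pi) := by
  have hd : ∀ z ∈ Ioo (0 : ℝ) Real.pi, HasDerivAt (fun z : ℝ => z * (Real.cos z / Real.sin z))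
      ((Real.cos z * Real.sin z - z) / Real.sin z ^ 2) z := by
    intro z hz
    have hs := Real.sin_pos_of_mem_Ioo hz
    refine ((hasDerivAt_id z).mul
      ((Real.hasDerivAt_cos z).div (Real.hasDerivAt_sin z) hs.ne')).congr_deriv ?_
    have h := Real.sin_sq_add_cos_sq z
    simp only [id, Pi.div_apply]
    field_simp
    linear_combination (-z) * h
  refine strictAntiOn_of_deriv_neg (convex_Ioo _ _)
    (fun z hz => (hd z hz).continuousAt.continuousWithinAt) ?_
  intro z hz
  rw [interior_Ioo] at hz
  rw [(hd z hz).deriv]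
  have hs := Real.sin_pos_of_mem_Ioo hz
  refine div_neg_of_neg_of_pos ?_ (by positivity)
  have h := Real.sin_lt (x := 2 * z) (by linarith [hz.1])
  rw [Real.sin_two_mul] at h
  linarith

/-- The logarithmic derivative of `nonlinF` in the variable `log x`, to the right of the zero
`α` of `nonlinF`. Since `sin² x - sin² α = sin (x - α) sin (x + α)`, it is a sum of decreasing
functions. -/
lemma logDeriv_anti {α x x' : ℝ} (hα : 0 < α) (hx : α < x) (hxx' : x < x')
    (hx' : x' < Real.pi / 2) :
    x' * (Real.cos x' ^ 2 - Real.sin x' ^ 2) / (Real.sin x' * Real.cos x') +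
        2 * x' * Real.sin x' * Real.cos x' / (Real.sin x' ^ 2 - Real.sin α ^ 2) <
      x * (Real.cos x ^ 2 - Real.sin x ^ 2) / (Real.sin x * Real.cos x) +
        2 * x * Real.sin x * Real.cos x / (Real.sin x ^ 2 - Real.sin α ^ 2) := by
  have hfac : ∀ y, Real.sin y ^ 2 - Real.sin α ^ 2 = Real.sin (y - α) * Real.sin (y + α) := by
    intro y
    rw [Real.sin_sub, Real.sin_add]
    have h1 := Real.sin_sq_add_cos_sq y
    have h2 := Real.sin_sq_add_cos_sq α
    linear_combination Real.sin α ^ 2 * h1 - Real.sin y ^ 2 * h2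
  have key : ∀ y, α < y → y < Real.pi / 2 →
      y * (Real.cos y ^ 2 - Real.sin y ^ 2) / (Real.sin y * Real.cos y) +
        2 * y * Real.sin y * Real.cos y / (Real.sin y ^ 2 - Real.sin α ^ 2) =
      y * (Real.cos y / Real.sin y) - y * Real.tan y +
      ((y - α) * (Real.cos (y - α) / Real.sin (y - α)) +
        (y + α) * (Real.cos (y + α) / Real.sin (y + α))) +
      2 * α * Real.sin α * Real.cos α / (Real.sin y ^ 2 - Real.sin α ^ 2) := by
    intro y h1 h2
    have hs : 0 < Real.sin y := Real.sin_pos_of_pos_of_lt_pi (by linarith) (by linarith)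
    have hc : 0 < Real.cos y := Real.cos_pos_of_mem_Ioo ⟨by linarith, h2⟩
    have hm : 0 < Real.sin (y - α) := Real.sin_pos_of_pos_of_lt_pi (by linarith) (by linarith)
    have hp : 0 < Real.sin (y + α) := Real.sin_pos_of_pos_of_lt_pi (by linarith) (by linarith)
    have e1 : 2 * Real.sin y * Real.cos y = Real.sin (y - α) * Real.cos (y + α) +
        Real.cos (y - α) * Real.sin (y + α) := by
      rw [← Real.sin_add, ← Real.sin_two_mul]; congr 1; ring
    have e2 : 2 * Real.sin α * Real.cos α = Real.sin (y + α) * Real.cos (y - α) -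
        Real.cos (y + α) * Real.sin (y - α) := by
      rw [← Real.sin_sub, ← Real.sin_two_mul]; congr 1; ring
    have e3 : 2 * y * Real.sin y * Real.cos y = y * (Real.sin (y - α) * Real.cos (y + α) +
        Real.cos (y - α) * Real.sin (y + α)) := by rw [← e1]; ring
    have e4 : 2 * α * Real.sin α * Real.cos α = α * (Real.sin (y + α) * Real.cos (y - α) -
        Real.cos (y + α) * Real.sin (y - α)) := by rw [← e2]; ring
    rw [hfac, e3, e4, Real.tan_eq_sin_div_cos]
    field_simp
    ring
  rw [key x hx (by linarith), key x' (by linarith) hx']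
  have hα2 : α < Real.pi / 2 := by linarith
  have g1 := strictAntiOn_mul_cot (a := x) (b := x') ⟨by linarith, by linarith⟩
    ⟨by linarith, by linarith⟩ hxx'
  have g2 := strictAntiOn_mul_cot (a := x - α) (b := x' - α) ⟨by linarith, by linarith⟩
    ⟨by linarith, by linarith⟩ (by linarith)
  have g3 := strictAntiOn_mul_cot (a := x + α) (b := x' + α) ⟨by linarith, by linarith⟩
    ⟨by linarith, by linarith⟩ (by linarith)
  have g4 : x * Real.tan x < x' * Real.tan x' := by
    have t1 : Real.tan x < Real.tan x' :=
      Real.tan_lt_tan_of_lt_of_lt_pi_div_two (by linarith) hx' hxx'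
    have t0 : 0 < Real.tan x := Real.tan_pos_of_pos_of_lt_pi_div_two (by linarith) (by linarith)
    nlinarith
  have g5 : 2 * α * Real.sin α * Real.cos α / (Real.sin x' ^ 2 - Real.sin α ^ 2) ≤
      2 * α * Real.sin α * Real.cos α / (Real.sin x ^ 2 - Real.sin α ^ 2) := by
    have hsα : 0 < Real.sin α := Real.sin_pos_of_pos_of_lt_pi hα (by linarith)
    have hcα : 0 < Real.cos α := Real.cos_pos_of_mem_Ioo ⟨by linarith, hα2⟩
    have m1 : Real.sin α < Real.sin x :=
      Real.sin_lt_sin_of_lt_of_le_pi_div_two (by linarith) (by linarith) hx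
    have m2 : Real.sin x < Real.sin x' :=
      Real.sin_lt_sin_of_lt_of_le_pi_div_two (by linarith) (by linarith) hxx'
    refine div_le_div_of_nonneg_left (by positivity) (by nlinarith) (by nlinarith)
  simp only at g1 g2 g3
  linarith

lemma nonlinF_sign_change {a b : ℝ} (hb : 0 < b) (hab : 2 * b < a) (l x x' : ℝ) (hl : 1 ≤ l)
    (hx : 0 < x) (hxx' : x < x') (hx' : x' < Real.pi / 2)
    (h : x * nonlinF' a b x ≤ l * nonlinF a b x) :
    x' * nonlinF' a b x' < l * nonlinF a b x' := by
  have ha : 0 < a := by linarith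
  set β := b / a with hβ
  have hβ0 : 0 < β := by positivity
  have hβ1 : β < 1 := by rw [hβ, div_lt_one ha]; linarith
  have eF : ∀ y, nonlinF a b y = a * (Real.sin y * Real.cos y * (Real.sin y ^ 2 - β)) := by
    intro y; rw [nonlinF, Real.sin_two_mul]; ring
  have eF' : ∀ y, nonlinF' a b y = a * ((Real.cos y ^ 2 - Real.sin y ^ 2) *
      (Real.sin y ^ 2 - β) + 2 * (Real.sin y * Real.cos y) ^ 2) := by
    intro y; rw [nonlinF', Real.sin_two_mul, Real.cos_two_mul']; ring
  have hs : 0 < Real.sin x := Real.sin_pos_of_pos_of_lt_pi hx (by linarith)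
  have hc : 0 < Real.cos x := Real.cos_pos_of_mem_Ioo ⟨by linarith, by linarith⟩
  have hs' : 0 < Real.sin x' := Real.sin_pos_of_pos_of_lt_pi (by linarith) (by linarith)
  have hc' : 0 < Real.cos x' := Real.cos_pos_of_mem_Ioo ⟨by linarith, by linarith⟩
  have hss : Real.sin x < Real.sin x' :=
    Real.sin_lt_sin_of_lt_of_le_pi_div_two (by linarith) (by linarith) hxx'
  -- To the left of the zero of `F` one has `F ≤ 0` and `x F' - F > 0`.
  have hgt : β < Real.sin x ^ 2 := by
    by_contra hcon
    push Not at hcon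
    rw [eF, eF'] at h
    have hm : 0 ≤ β - Real.sin x ^ 2 := by linarith
    have h1 := mul_cos_lt_sin hx (by linarith)
    have p1 : 0 ≤ (l - 1) * (Real.sin x * Real.cos x * (β - Real.sin x ^ 2)) := by
      have : 0 ≤ l - 1 := by linarith
      positivity
    have p2 : 0 ≤ (β - Real.sin x ^ 2) * (Real.cos x * (Real.sin x - x * Real.cos x)) := by
      have : 0 < Real.sin x - x * Real.cos x := by linarith
      positivity
    have p3 : 0 ≤ (β - Real.sin x ^ 2) * (x * Real.sin x ^ 2) := by positivity
    have p4 : 0 < 2 * x * (Real.sin x * Real.cos x) ^ 2 := by positivity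
    have h2 : x * ((Real.cos x ^ 2 - Real.sin x ^ 2) *
      (Real.sin x ^ 2 - β) + 2 * (Real.sin x * Real.cos x) ^ 2) ≤
        l * (Real.sin x * Real.cos x * (Real.sin x ^ 2 - β)) := by
      have : a * (x * ((Real.cos x ^ 2 - Real.sin x ^ 2) *
        (Real.sin x ^ 2 - β) + 2 * (Real.sin x * Real.cos x) ^ 2)) ≤
        a * (l * (Real.sin x * Real.cos x * (Real.sin x ^ 2 - β))) := by linarith
      exact le_of_mul_le_mul_left this ha
    nlinarith
  have hgt' : β < Real.sin x' ^ 2 := by nlinarith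
  set α := Real.arcsin (Real.sqrt β) with hα
  have hsq0 : 0 < Real.sqrt β := Real.sqrt_pos.2 hβ0
  have hsq1 : Real.sqrt β ≤ 1 := Real.sqrt_le_one.2 hβ1.le
  have hsinα : Real.sin α = Real.sqrt β := Real.sin_arcsin (by linarith) hsq1
  have hsinα2 : Real.sin α ^ 2 = β := by rw [hsinα, Real.sq_sqrt hβ0.le]
  have hα0 : 0 < α := Real.arcsin_pos.2 hsq0
  have hαx : α < x := by
    rw [hα, Real.arcsin_lt_iff_lt_sin' ⟨by linarith, by linarith⟩]
    rw [Real.sqrt_lt' hs]; exact hgt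
  have hanti := logDeriv_anti hα0 hαx hxx' hx'
  rw [hsinα2] at hanti
  have hF : ∀ y, 0 < Real.sin y → 0 < Real.cos y → β < Real.sin y ^ 2 →
      y * nonlinF' a b y = (y * (Real.cos y ^ 2 - Real.sin y ^ 2) / (Real.sin y * Real.cos y) +
        2 * y * Real.sin y * Real.cos y / (Real.sin y ^ 2 - β)) * nonlinF a b y := by
    intro y h1 h2 h3
    have h4 : Real.sin y ^ 2 - β ≠ 0 := (sub_pos.2 h3).ne'
    rw [eF, eF']
    field_simp
  have hFpos : ∀ y, 0 < Real.sin y → 0 < Real.cos y → β < Real.sin y ^ 2 →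
      0 < nonlinF a b y := by
    intro y h1 h2 h3
    have h4 : 0 < Real.sin y ^ 2 - β := by linarith
    rw [eF]; positivity
  have hlow := le_of_mul_le_mul_right ((hF x hs hc hgt) ▸ h) (hFpos x hs hc hgt)
  rw [hF x' hs' hc' hgt']
  exact mul_lt_mul_of_pos_right (by linarith) (hFpos x' hs' hc' hgt')

lemma groundStateNonlinearity_nonlinF {a b : ℝ} (hb : 0 < b) (hab : 2 * b < a) :
    GroundStateNonlinearity (nonlinF a b) (nonlinF' a b) (potential a b) (Real.pi / 2)
      a (3 * a) := by
  have ha : 0 < a := by linarith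
  have hβ0 : 0 < b / a := by positivity
  have hβ1 : 2 * (b / a) < 1 := by
    rw [← mul_div_assoc, div_lt_one ha]; linarith
  refine ⟨by positivity, ha.le, by positivity, hasDerivAt_nonlinF a b, hasDerivAt_potential a b,
    by simp [nonlinF], by simp [potential], ?_, ?_, ?_, ?_, ?_, ?_, ?_, ?_⟩
  · simp only [potential, Real.sin_pi_div_two]
    have : 0 < 1 - 2 * (b / a) := by linarith
    norm_num
    positivity
  · intro x
    simp only [potential, Real.sin_pi_div_two]
    have h0 : 0 ≤ Real.sin x ^ 2 := sq_nonneg _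
    have h1 : Real.sin x ^ 2 ≤ 1 := Real.sin_sq_le_one x
    have h2 : 0 ≤ (1 - Real.sin x ^ 2) * (Real.sin x ^ 2 + 1 - 2 * (b / a)) := by
      apply mul_nonneg <;> linarith
    have h3 : 0 ≤ a / 4 * ((1 - Real.sin x ^ 2) * (Real.sin x ^ 2 + 1 - 2 * (b / a))) := by
      positivity
    linarith
  · intro x
    rw [nonlinF'_eq, abs_mul, abs_of_pos (show 0 < a / 2 by positivity)]
    have h1 := Real.abs_cos_le_one (2 * x)
    have h2 := Real.abs_cos_le_one (2 * (2 * x))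
    have h3 : |(1 - 2 * (b / a)) * Real.cos (2 * x)| ≤ 1 * 1 := by
      rw [abs_mul]
      exact mul_le_mul (by rw [abs_le]; constructor <;> linarith) h1 (abs_nonneg _) (by norm_num)
    have h4 := abs_sub ((1 - 2 * (b / a)) * Real.cos (2 * x)) (Real.cos (2 * (2 * x)))
    nlinarith
  · intro x y
    have hcos : ∀ x y : ℝ, |Real.cos x - Real.cos y| ≤ |x - y| := by
      intro x y
      have := Real.lipschitzWith_cos.dist_le_mul x y
      simpa [Real.dist_eq] using this
    rw [nonlinF'_eq, nonlinF'_eq, ← mul_sub, abs_mul, abs_of_pos (show 0 < a / 2 by positivity)]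
    have h1 := hcos (2 * x) (2 * y)
    have h2 := hcos (2 * (2 * x)) (2 * (2 * y))
    have e1 : |2 * x - 2 * y| = 2 * |x - y| := by rw [← mul_sub, abs_mul]; norm_num
    have e2 : |2 * (2 * x) - 2 * (2 * y)| = 2 * (2 * |x - y|) := by
      rw [← mul_sub, abs_mul, e1]; norm_num
    have h3 : |(1 - 2 * (b / a)) * (Real.cos (2 * x) - Real.cos (2 * y))| ≤ 1 * (2 * |x - y|) := by
      rw [abs_mul]
      exact mul_le_mul (by rw [abs_le]; constructor <;> linarith) (by linarith) (abs_nonneg _)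
        (by norm_num)
    have h4 := abs_sub ((1 - 2 * (b / a)) * (Real.cos (2 * x) - Real.cos (2 * y)))
      (Real.cos (2 * (2 * x)) - Real.cos (2 * (2 * y)))
    have e3 : (1 - 2 * (b / a)) * Real.cos (2 * x) - Real.cos (2 * (2 * x)) -
        ((1 - 2 * (b / a)) * Real.cos (2 * y) - Real.cos (2 * (2 * y))) =
        (1 - 2 * (b / a)) * (Real.cos (2 * x) - Real.cos (2 * y)) -
        (Real.cos (2 * (2 * x)) - Real.cos (2 * (2 * y))) := by ring
    rw [e3]
    nlinarith
  · rw [nonlinF'_eq]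
    simp
    positivity
  · intro x h0 h1 h
    have hs : 0 < Real.sin x := Real.sin_pos_of_pos_of_lt_pi h0 (by linarith [Real.pi_pos])
    have hc : 0 < Real.cos x := Real.cos_pos_of_mem_Ioo ⟨by linarith, by linarith⟩
    rw [potential] at h
    have h2 : 0 ≤ Real.sin x ^ 2 - 2 * (b / a) :=
      nonneg_of_mul_nonneg_right h (by positivity)
    have h3 : 0 < Real.sin x ^ 2 - b / a := by linarith
    rw [nonlinF, Real.sin_two_mul]
    positivity
  · intro x x' h0 hxx' hx' h
    have hs : 0 < Real.sin x := Real.sin_pos_of_pos_of_lt_pi h0 (by linarith [Real.pi_pos])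
    have hc : 0 < Real.cos x := Real.cos_pos_of_mem_Ioo ⟨by linarith, by linarith⟩
    have hs' : 0 < Real.sin x' :=
      Real.sin_pos_of_pos_of_lt_pi (by linarith) (by linarith [Real.pi_pos])
    have hc' : 0 < Real.cos x' := Real.cos_pos_of_mem_Ioo ⟨by linarith, by linarith⟩
    have hss : Real.sin x < Real.sin x' :=
      Real.sin_lt_sin_of_lt_of_le_pi_div_two (by linarith) (by linarith) hxx'
    rw [nonlinF, Real.sin_two_mul] at h
    have h2 : 0 ≤ Real.sin x ^ 2 - b / a := nonneg_of_mul_nonneg_right h (by positivity)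
    have h3 : 0 < Real.sin x' ^ 2 - b / a := by nlinarith
    rw [nonlinF, Real.sin_two_mul]
    positivity
  · exact nonlinF_sign_change hb hab

end Trigonometry

/-! ### The radial initial value problem -/

/-- `u` solves `u'' + (n/r) u' + G(r, u) = 0` on `(0, ∞)` with `u'(0) = 0`, and `p` is its
derivative. Here `n = d - 1`. -/
structure RadialSolution (n : ℕ) (G : ℝ → ℝ → ℝ) (u p : ℝ → ℝ) : Prop where
  cont_u : ContinuousOn u (Ici 0)
  cont_p : ContinuousOn p (Ici 0)
  p_zero : p 0 = 0
  hasDerivAt_u : ∀ r, 0 < r → HasDerivAt u (p r) r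
  hasDerivAt_p : ∀ r, 0 < r → HasDerivAt p (-(n / r * p r) - G r (u r)) r

lemma RadialSolution.hasDerivWithinAt {n : ℕ} {G : ℝ → ℝ → ℝ} {u p : ℝ → ℝ}
    (h : RadialSolution n G u p) {r : ℝ} (hr : 0 ≤ r) :
    HasDerivWithinAt u (p r) (Ici 0) r := by
  rcases hr.eq_or_lt with rfl | hr
  · refine hasDerivWithinAt_Ici_of_tendsto_deriv (s := Ioi 0)
      (fun x hx => (h.hasDerivAt_u x hx).differentiableAt.differentiableWithinAt)
      ((h.cont_u 0 self_mem_Ici).mono Ioi_subset_Ici_self) self_mem_nhdsWithin ?_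
    have := (h.cont_p 0 self_mem_Ici).mono Ioi_subset_Ici_self
    refine Tendsto.congr' ?_ this
    filter_upwards [self_mem_nhdsWithin] with x hx
    exact (h.hasDerivAt_u x hx).deriv.symm
  · exact (h.hasDerivAt_u r hr).hasDerivWithinAt

lemma RadialSolution.radDeriv_eq {n : ℕ} {G : ℝ → ℝ → ℝ} {u p : ℝ → ℝ}
    (h : RadialSolution n G u p) {r : ℝ} (hr : 0 ≤ r) : radDeriv u r = p r :=
  (h.hasDerivWithinAt hr).derivWithin (uniqueDiffOn_Ici 0 r hr)

lemma RadialSolution.solvesRadialODE {n : ℕ} {G : ℝ → ℝ → ℝ} {u p : ℝ → ℝ}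
    (h : RadialSolution n G u p) : SolvesRadialODE (n + 1) G u := by
  have he : EqOn (radDeriv u) p (Ici 0) := fun r hr => h.radDeriv_eq hr
  refine ⟨fun r hr => (h.hasDerivWithinAt hr).differentiableWithinAt, h.cont_p.congr he,
    (he self_mem_Ici).trans h.p_zero, fun r hr => ?_⟩
  have hev : radDeriv u =ᶠ[𝓝 r] p := by
    filter_upwards [Ioi_mem_nhds hr] with x hx using he (le_of_lt (mem_Ioi.1 hx))
  have hd := (h.hasDerivAt_p r hr).congr_of_eventuallyEq hev
  refine ⟨hd.differentiableAt, ?_⟩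
  rw [hd.deriv, he hr.le]
  push_cast
  ring

lemma SolvesRadialODE.radialSolution {n : ℕ} {G : ℝ → ℝ → ℝ} {u : ℝ → ℝ}
    (h : SolvesRadialODE (n + 1) G u) : RadialSolution n G u (radDeriv u) := by
  obtain ⟨h1, h2, h3, h4⟩ := h
  refine ⟨h1.continuousOn, h2, h3, fun r hr => ?_, fun r hr => ?_⟩
  · exact ((h1 r hr.le).hasDerivWithinAt).hasDerivAt (Ici_mem_nhds hr)
  · obtain ⟨h5, h6⟩ := h4 r hr
    refine h5.hasDerivAt.congr_deriv ?_
    push_cast at h6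
    linear_combination h6

/-! ### Gronwall estimates -/

/-- Gronwall's inequality for `z'' + (n/r) z' + s = 0` with vanishing data at the singular point
`r = 0`: the damping term has the good sign in the derivative of `z² + z'²`. -/
lemma gronwall_radial {n : ℕ} {z q s : ℝ → ℝ} {A D R : ℝ} (hA : 0 ≤ A)
    (hz : ContinuousOn z (Ici 0)) (hq : ContinuousOn q (Ici 0)) (hz0 : z 0 = 0) (hq0 : q 0 = 0)
    (hzd : ∀ r, 0 < r → HasDerivAt z (q r) r)
    (hqd : ∀ r, 0 < r → HasDerivAt q (-(n / r * q r) - s r) r)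
    (hs : ∀ r, 0 < r → r < R → |s r| ≤ A * |z r| + D) {r : ℝ} (hr : 0 ≤ r) (hrR : r ≤ R) :
    z r ^ 2 + q r ^ 2 ≤ D ^ 2 * Real.exp ((2 + A) * r) := by
  set E : ℝ → ℝ := fun r => Real.exp (-((2 + A) * r)) * (z r ^ 2 + q r ^ 2 + D ^ 2) with hE
  have hsub : Icc 0 R ⊆ Ici (0 : ℝ) := fun x hx => hx.1
  have hanti : AntitoneOn E (Icc 0 R) := by
    refine antitoneOn_of_hasDerivWithinAt_nonpos (convex_Icc 0 R)
      (f' := fun r => Real.exp (-((2 + A) * r)) * (-(2 + A)) * (z r ^ 2 + q r ^ 2 + D ^ 2) +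
        Real.exp (-((2 + A) * r)) * (2 * z r * q r + 2 * q r * (-(n / r * q r) - s r))) ?_ ?_ ?_
    · exact (Continuous.continuousOn (by fun_prop)).mul
        ((((hz.mono hsub).pow 2).add ((hq.mono hsub).pow 2)).add continuousOn_const)
    · intro x hx
      rw [interior_Icc] at hx
      have e1 : HasDerivAt (fun r => Real.exp (-((2 + A) * r)))
          (Real.exp (-((2 + A) * x)) * (-(2 + A))) x := by
        simpa using ((hasDerivAt_id x).const_mul (2 + A)).neg.exp
      have e2 := (((hzd x hx.1).pow 2).add ((hqd x hx.1).pow 2)).add_const (D ^ 2)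
      refine ((e1.mul e2).congr_deriv ?_).hasDerivWithinAt
      simp
    · intro x hx
      rw [interior_Icc] at hx
      have h1 := hs x hx.1 hx.2
      have h2 : 0 ≤ n / x * q x ^ 2 := by
        have := hx.1
        positivity
      have h3 : -(q x * s x) ≤ |q x| * (A * |z x| + D) := by
        calc -(q x * s x) ≤ |q x * s x| := neg_le_abs _
          _ = |q x| * |s x| := abs_mul _ _
          _ ≤ _ := by gcongr
      have h4 : z x * q x ≤ |q x| * |z x| := by
        rw [mul_comm, ← abs_mul]; exact le_abs_self _
      have h5 : 2 * (|q x| * |z x|) ≤ z x ^ 2 + q x ^ 2 := by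
        nlinarith [sq_nonneg (|q x| - |z x|), sq_abs (q x), sq_abs (z x)]
      have h6 : 2 * (|q x| * D) ≤ q x ^ 2 + D ^ 2 := by
        nlinarith [sq_nonneg (|q x| - D), sq_abs (q x)]
      have h7 : 0 ≤ A * (z x ^ 2 + q x ^ 2 - 2 * (|q x| * |z x|)) := by
        apply mul_nonneg hA; linarith
      have h8 : 0 ≤ A * D ^ 2 := by positivity
      have h9 : 2 * z x * q x + 2 * q x * (-(n / x * q x) - s x) ≤
          (2 + A) * (z x ^ 2 + q x ^ 2 + D ^ 2) := by
        nlinarith [sq_nonneg (z x), sq_nonneg D]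
      have h10 := Real.exp_pos (-((2 + A) * x))
      nlinarith
  have hle := hanti ⟨le_refl 0, hr.trans hrR⟩ ⟨hr, hrR⟩ hr
  simp only [hE, hz0, hq0] at hle
  norm_num at hle
  rw [Real.exp_neg, inv_mul_le_iff₀ (Real.exp_pos _)] at hle
  nlinarith [sq_nonneg D]

/-- Backward uniqueness from a regular point. -/
lemma eq_zero_of_regular_zero {n : ℕ} {z q s : ℝ → ℝ} {A R : ℝ} (hA : 0 ≤ A) (hR : 0 < R)
    (hz : ContinuousOn z (Ici 0)) (hzR : z R = 0) (hqR : q R = 0)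
    (hzd : ∀ r, 0 < r → HasDerivAt z (q r) r)
    (hqd : ∀ r, 0 < r → HasDerivAt q (-(n / r * q r) - s r) r)
    (hs : ∀ r, 0 < r → r < R → |s r| ≤ A * |z r|) : z 0 = 0 := by
  have hpos : ∀ r, 0 < r → r ≤ R → z r = 0 := by
    intro e he heR
    set K := 1 + A + 2 * (n / e) with hK
    set E : ℝ → ℝ := fun r => Real.exp (K * r) * (z r ^ 2 + q r ^ 2) with hE
    have hmono : MonotoneOn E (Icc e R) := by
      have hd : ∀ x, 0 < x → HasDerivAt E (Real.exp (K * x) * K * (z x ^ 2 + q x ^ 2) +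
          Real.exp (K * x) * (2 * z x * q x + 2 * q x * (-(n / x * q x) - s x))) x := by
        intro x hx
        have e1 : HasDerivAt (fun r => Real.exp (K * r)) (Real.exp (K * x) * K) x := by
          simpa using ((hasDerivAt_id x).const_mul K).exp
        have e2 := ((hzd x hx).pow 2).add ((hqd x hx).pow 2)
        refine (e1.mul e2).congr_deriv ?_
        simp
      refine monotoneOn_of_hasDerivWithinAt_nonneg (convex_Icc e R)
        (fun x hx => (hd x (he.trans_le hx.1)).continuousAt.continuousWithinAt)
        (fun x hx => (hd x ?_).hasDerivWithinAt) ?_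
      · rw [interior_Icc] at hx; exact he.trans hx.1
      · intro x hx
        rw [interior_Icc] at hx
        have hx0 := he.trans hx.1
        have h1 := hs x hx0 hx.2
        have h2 : n / x * q x ^ 2 ≤ n / e * q x ^ 2 := by
          gcongr; exact hx.1.le
        have h2' : 0 ≤ n / e * z x ^ 2 := by positivity
        have h3 : q x * s x ≤ |q x| * (A * |z x|) := by
          calc q x * s x ≤ |q x * s x| := le_abs_self _
            _ = |q x| * |s x| := abs_mul _ _
            _ ≤ _ := by gcongr
        have h4 : -(z x * q x) ≤ |q x| * |z x| := by
          rw [mul_comm, ← abs_mul]; exact neg_le_abs _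
        have h5 : 2 * (|q x| * |z x|) ≤ z x ^ 2 + q x ^ 2 := by
          nlinarith [sq_nonneg (|q x| - |z x|), sq_abs (q x), sq_abs (z x)]
        have h7 : 0 ≤ A * (z x ^ 2 + q x ^ 2 - 2 * (|q x| * |z x|)) := by
          apply mul_nonneg hA; linarith
        have h9 : 0 ≤ K * (z x ^ 2 + q x ^ 2) +
            (2 * z x * q x + 2 * q x * (-(n / x * q x) - s x)) := by
          rw [hK]; nlinarith
        have h10 := Real.exp_pos (K * x)
        nlinarith
    have hle := hmono ⟨le_refl e, heR⟩ ⟨heR, le_refl R⟩ heR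
    simp only [hE, hzR, hqR] at hle
    norm_num at hle
    have h11 := nonpos_of_mul_nonpos_right hle (Real.exp_pos _)
    nlinarith [sq_nonneg (z e), sq_nonneg (q e)]
  have hlim : Tendsto z (𝓝[>] 0) (𝓝 (z 0)) :=
    (hz 0 self_mem_Ici).mono Ioi_subset_Ici_self
  have hlim' : Tendsto z (𝓝[>] 0) (𝓝 0) := by
    refine tendsto_const_nhds.congr' ?_
    filter_upwards [Ioc_mem_nhdsGT hR] with x hx using (hpos x hx.1 hx.2).symm
  exact tendsto_nhds_unique hlim hlim'

/-- Lipschitz dependence of a solution and of its derivative on the initial value. -/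
lemma RadialSolution.abs_sub_le {n : ℕ} {G : ℝ → ℝ → ℝ} {u p u' p' : ℝ → ℝ} {L : ℝ} (hL : 0 ≤ L)
    (hG : ∀ r, 0 < r → ∀ x y, |G r x - G r y| ≤ L * |x - y|)
    (h : RadialSolution n G u p) (h' : RadialSolution n G u' p') {r : ℝ} (hr : 0 ≤ r) :
    |u r - u' r| ≤ (1 + L * Real.exp ((2 + L) * r)) * |u 0 - u' 0| ∧
    |p r - p' r| ≤ (1 + L * Real.exp ((2 + L) * r)) * |u 0 - u' 0| := by
  set δ := u 0 - u' 0 with hδ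
  have hg := gronwall_radial (n := n) (z := fun r => u r - u' r - δ) (q := fun r => p r - p' r)
    (s := fun r => G r (u r) - G r (u' r)) (A := L) (D := L * |δ|) (R := r) hL
    ((h.cont_u.sub h'.cont_u).sub continuousOn_const) (h.cont_p.sub h'.cont_p) (by simp [hδ])
    (by simp [h.p_zero, h'.p_zero])
    (fun r hr => ((h.hasDerivAt_u r hr).sub (h'.hasDerivAt_u r hr)).sub_const δ)
    (fun r hr => ((h.hasDerivAt_p r hr).sub (h'.hasDerivAt_p r hr)).congr_deriv (by ring))
    (fun r hr _ => by
      refine (hG r hr _ _).trans ?_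
      rw [← mul_add]
      refine mul_le_mul_of_nonneg_left ?_ hL
      have := abs_add_le (u r - u' r - δ) δ
      simpa using this) hr le_rfl
  have hexp : (L * |δ|) ^ 2 * Real.exp ((2 + L) * r) ≤
      (L * |δ| * Real.exp ((2 + L) * r)) ^ 2 := by
    have h1 : 1 ≤ Real.exp ((2 + L) * r) := Real.one_le_exp (by positivity)
    rw [mul_pow _ (Real.exp _)]
    refine mul_le_mul_of_nonneg_left ?_ (sq_nonneg _)
    nlinarith
  have hnn : 0 ≤ L * |δ| * Real.exp ((2 + L) * r) := by positivity
  have hz : |u r - u' r - δ| ≤ L * |δ| * Real.exp ((2 + L) * r) :=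
    abs_le_of_sq_le_sq (by nlinarith [sq_nonneg (p r - p' r)]) hnn
  have hq : |p r - p' r| ≤ L * |δ| * Real.exp ((2 + L) * r) :=
    abs_le_of_sq_le_sq (by nlinarith [sq_nonneg (u r - u' r - δ)]) hnn
  constructor
  · have := abs_add_le (u r - u' r - δ) δ
    rw [sub_add_cancel] at this
    linarith
  · linarith [abs_nonneg δ]

lemma RadialSolution.unique {n : ℕ} {G : ℝ → ℝ → ℝ} {u p u' p' : ℝ → ℝ} {L : ℝ} (hL : 0 ≤ L)
    (hG : ∀ r, 0 < r → ∀ x y, |G r x - G r y| ≤ L * |x - y|)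
    (h : RadialSolution n G u p) (h' : RadialSolution n G u' p') (h0 : u 0 = u' 0) :
    EqOn u u' (Ici 0) := by
  intro r hr
  have := (h.abs_sub_le hL hG h' hr).1
  rw [h0, sub_self, abs_zero, mul_zero] at this
  exact sub_eq_zero.1 (abs_nonpos_iff.1 this)

/-- A nontrivial solution does not pass through the origin of the phase plane. -/
lemma RadialSolution.deriv_ne_zero_of_eq_zero {n : ℕ} {G : ℝ → ℝ → ℝ} {u p : ℝ → ℝ} {L : ℝ}
    (hL : 0 ≤ L) (hG : ∀ r, 0 < r → ∀ x, |G r x| ≤ L * |x|)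
    (h : RadialSolution n G u p) (h0 : u 0 ≠ 0) {r : ℝ} (hr : 0 < r) (hur : u r = 0) :
    p r ≠ 0 := fun hp =>
  h0 (eq_zero_of_regular_zero hL hr h.cont_u hur hp h.hasDerivAt_u h.hasDerivAt_p
    fun r hr _ => hG r hr _)

/-! ### Existence for the radial initial value problem -/

/-- The function `A` with `A' + (n/s) A = h` and `A(0) = 0`, namely
`s ↦ s⁻ⁿ ∫₀ˢ tⁿ h(t) dt`, rescaled so that it is visibly continuous at `s = 0`. -/
noncomputable def radialAverage (n : ℕ) (h : ℝ → ℝ) (s : ℝ) : ℝ :=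
  s * ∫ τ in (0 : ℝ)..1, τ ^ n * h (s * τ)

lemma continuous_radialAverage (n : ℕ) {h : ℝ → ℝ} (hh : Continuous h) :
    Continuous (radialAverage n h) := by
  refine continuous_id.mul ?_
  exact intervalIntegral.continuous_parametric_intervalIntegral_of_continuous' (by fun_prop) 0 1

lemma radialAverage_sub (n : ℕ) {h k : ℝ → ℝ} (hh : Continuous h) (hk : Continuous k) (s : ℝ) :
    radialAverage n (fun t => h t - k t) s = radialAverage n h s - radialAverage n k s := by
  rw [radialAverage, radialAverage, radialAverage, ← mul_sub, ← intervalIntegral.integral_sub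
    (Continuous.intervalIntegrable (by fun_prop) _ _)
    (Continuous.intervalIntegrable (by fun_prop) _ _)]
  simp only [mul_sub]

lemma hasDerivAt_radialAverage (n : ℕ) {h : ℝ → ℝ} (hh : Continuous h) {s : ℝ} (hs : 0 < s) :
    HasDerivAt (radialAverage n h) (h s - n / s * radialAverage n h s) s := by
  have key : ∀ s : ℝ, 0 < s → radialAverage n h s = (∫ t in (0 : ℝ)..s, t ^ n * h t) / s ^ n := by
    intro s hs
    have h1 := intervalIntegral.integral_comp_mul_left (a := 0) (b := 1)
      (fun t => t ^ n * h t) hs.ne'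
    simp only [mul_zero, mul_one, smul_eq_mul, mul_pow] at h1
    have h2 : ∫ τ in (0 : ℝ)..1, s ^ n * τ ^ n * h (s * τ) =
        s ^ n * ∫ τ in (0 : ℝ)..1, τ ^ n * h (s * τ) := by
      rw [← intervalIntegral.integral_const_mul]; simp only [mul_assoc]
    rw [h2] at h1
    have hsn : s ^ n ≠ 0 := by positivity
    rw [radialAverage, eq_div_iff hsn]
    field_simp at h1
    linear_combination h1
  have hev : radialAverage n h =ᶠ[𝓝 s] fun s => (∫ t in (0 : ℝ)..s, t ^ n * h t) / s ^ n := by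
    filter_upwards [Ioi_mem_nhds hs] with x hx using key x hx
  have hcont : Continuous fun t => t ^ n * h t := by fun_prop
  have hd := (hcont.integral_hasStrictDerivAt 0 s).hasDerivAt
  have hsn : s ^ n ≠ 0 := by positivity
  refine ((hd.div (hasDerivAt_pow n s) hsn).congr_of_eventuallyEq hev).congr_deriv ?_
  rw [key s hs]
  rcases n with _ | n
  · simp
  · push_cast
    field_simp
    ring

/-- The Gaussian weight `exp(K r²)` turns the integral operator into a contraction. -/
lemma abs_integral_radialAverage_le (n : ℕ) {h : ℝ → ℝ} {K D : ℝ} (hK : 0 < K)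
    (hD : ∀ t, |h t| ≤ D * Real.exp (K * t ^ 2)) {r : ℝ} (hr : 0 ≤ r) :
    |∫ s in (0 : ℝ)..r, radialAverage n h s| ≤ D / (2 * K) * Real.exp (K * r ^ 2) := by
  have hD0 : 0 ≤ D := by
    have := (abs_nonneg _).trans (hD 0)
    simpa using this
  have h1 : ∀ s, 0 ≤ s → |radialAverage n h s| ≤ s * (D * Real.exp (K * s ^ 2)) := by
    intro s hs
    rw [radialAverage, abs_mul, abs_of_nonneg hs]
    refine mul_le_mul_of_nonneg_left ?_ hs
    have := intervalIntegral.norm_integral_le_of_norm_le_const (a := 0) (b := 1)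
      (f := fun τ => τ ^ n * h (s * τ)) (C := D * Real.exp (K * s ^ 2)) ?_
    · simpa using this
    · intro τ hτ
      rw [uIoc_of_le zero_le_one] at hτ
      have hτn : τ ^ n ≤ 1 := pow_le_one₀ hτ.1.le hτ.2
      have hτn0 : 0 ≤ τ ^ n := pow_nonneg hτ.1.le n
      rw [Real.norm_eq_abs, abs_mul, abs_of_nonneg hτn0]
      have h2 : |h (s * τ)| ≤ D * Real.exp (K * s ^ 2) := by
        refine (hD _).trans ?_
        gcongr
        · exact mul_nonneg hs hτ.1.le
        · exact mul_le_of_le_one_right hs hτ.2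
      calc τ ^ n * |h (s * τ)| ≤ 1 * |h (s * τ)| := by gcongr
        _ ≤ _ := by rw [one_mul]; exact h2
  have hcont : Continuous fun s => s * (D * Real.exp (K * s ^ 2)) := by fun_prop
  have h3 := intervalIntegral.norm_integral_le_of_norm_le (f := radialAverage n h)
    (g := fun s => s * (D * Real.exp (K * s ^ 2))) (μ := MeasureTheory.volume) hr
    (Eventually.of_forall fun t ht => by
      rw [Real.norm_eq_abs]; exact h1 t ht.1.le) (hcont.intervalIntegrable _ _)
  have h4 : ∫ s in (0 : ℝ)..r, s * (D * Real.exp (K * s ^ 2)) =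
      D / (2 * K) * Real.exp (K * r ^ 2) - D / (2 * K) * Real.exp (K * 0 ^ 2) := by
    refine intervalIntegral.integral_eq_sub_of_hasDerivAt
      (f := fun r => D / (2 * K) * Real.exp (K * r ^ 2)) (fun x _ => ?_)
      (hcont.intervalIntegrable _ _)
    have := (((hasDerivAt_pow 2 x).const_mul K).exp).const_mul (D / (2 * K))
    refine this.congr_deriv ?_
    push_cast
    field_simp
  rw [h4, Real.norm_eq_abs] at h3
  have h5 : 0 ≤ D / (2 * K) * Real.exp (K * 0 ^ 2) := by positivity
  linarith

open BoundedContinuousFunction in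
lemma exists_radialSolution (n : ℕ) {G : ℝ → ℝ → ℝ} {L C : ℝ} (hL : 0 ≤ L)
    (hGc : Continuous fun x : ℝ × ℝ => G x.1 x.2)
    (hG : ∀ r x y, |G r x - G r y| ≤ L * |x - y|) (hC : ∀ r, |G r 0| ≤ C) (y : ℝ) :
    ∃ u p, RadialSolution n G u p ∧ u 0 = y := by
  set K := L + 1 with hK
  have hK0 : 0 < K := by positivity
  have hC0 : 0 ≤ C := (abs_nonneg _).trans (hC 0)
  let N : (ℝ →ᵇ ℝ) → ℝ → ℝ := fun g t => G t (Real.exp (K * t ^ 2) * g t)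
  have hN : ∀ g, Continuous (N g) := fun g => hGc.comp (f := fun t =>
    (t, Real.exp (K * t ^ 2) * g t)) (by fun_prop)
  have hNb : ∀ g t, |N g t| ≤ (C + L * ‖g‖) * Real.exp (K * t ^ 2) := by
    intro g t
    have h1 : 1 ≤ Real.exp (K * t ^ 2) := Real.one_le_exp (by positivity)
    have h2 := hG t (Real.exp (K * t ^ 2) * g t) 0
    rw [sub_zero, abs_mul, Real.abs_exp] at h2
    have h3 : |g t| ≤ ‖g‖ := g.norm_coe_le_norm t
    have h4 := abs_add_le (N g t - G t 0) (G t 0)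
    rw [sub_add_cancel] at h4
    have h5 : L * (Real.exp (K * t ^ 2) * |g t|) ≤ L * (Real.exp (K * t ^ 2) * ‖g‖) := by
      gcongr
    have h6 := hC t
    have h7 : |N g t - G t 0| ≤ L * (Real.exp (K * t ^ 2) * |g t|) := h2
    nlinarith
  have hNd : ∀ g g' t, |N g t - N g' t| ≤ (L * dist g g') * Real.exp (K * t ^ 2) := by
    intro g g' t
    refine (hG t _ _).trans ?_
    rw [← mul_sub, abs_mul, Real.abs_exp]
    have h3 : |g t - g' t| ≤ dist g g' := g.dist_coe_le_dist t
    have : L * (Real.exp (K * t ^ 2) * |g t - g' t|) ≤ L * (Real.exp (K * t ^ 2) * dist g g') := by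
      gcongr
    linarith
  let S : (ℝ →ᵇ ℝ) → ℝ → ℝ := fun g r => y - ∫ s in (0 : ℝ)..r, radialAverage n (N g) s
  have hScont : ∀ g, Continuous (S g) := fun g => continuous_const.sub
    (intervalIntegral.continuous_primitive
      (fun a b => (continuous_radialAverage n (hN g)).intervalIntegrable a b) 0)
  let T : (ℝ →ᵇ ℝ) → (ℝ →ᵇ ℝ) := fun g =>
    ofNormedAddCommGroup (fun r => Real.exp (-(K * r ^ 2)) * S g (|r|))
      ((by fun_prop : Continuous fun r : ℝ => Real.exp (-(K * r ^ 2))).mul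
        ((hScont g).comp continuous_abs)) (|y| + (C + L * ‖g‖) / (2 * K)) (by
      intro r
      have h1 := abs_integral_radialAverage_le n hK0 (hNb g) (abs_nonneg r)
      rw [sq_abs] at h1
      have h2 : |S g (|r|)| ≤ |y| + (C + L * ‖g‖) / (2 * K) * Real.exp (K * r ^ 2) :=
        (abs_sub _ _).trans (by linarith)
      rw [Real.norm_eq_abs, abs_mul, Real.abs_exp, Real.exp_neg, inv_mul_le_iff₀ (Real.exp_pos _)]
      have h3 : 1 ≤ Real.exp (K * r ^ 2) := Real.one_le_exp (by positivity)
      nlinarith [abs_nonneg y])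
  have hT : ContractingWith (1 / 2) T := by
    refine ⟨by rw [← NNReal.coe_lt_coe]; norm_num, LipschitzWith.of_dist_le_mul fun g g' => ?_⟩
    rw [BoundedContinuousFunction.dist_le (by positivity)]
    intro r
    have h1 := abs_integral_radialAverage_le n hK0 (h := N g - N g') (hNd g g') (abs_nonneg r)
    rw [sq_abs] at h1
    have h2 : ∫ s in (0 : ℝ)..|r|, radialAverage n (N g - N g') s =
        S g' (|r|) - S g (|r|) := by
      have : ∀ s, radialAverage n (N g - N g') s =
          radialAverage n (N g) s - radialAverage n (N g') s :=
        fun s => radialAverage_sub n (hN g) (hN g') s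
      simp only [this]
      rw [intervalIntegral.integral_sub
        ((continuous_radialAverage n (hN g)).intervalIntegrable _ _)
        ((continuous_radialAverage n (hN g')).intervalIntegrable _ _)]
      simp only [S]
      ring
    rw [h2] at h1
    change |Real.exp (-(K * r ^ 2)) * S g (|r|) - Real.exp (-(K * r ^ 2)) * S g' (|r|)| ≤ _
    rw [← mul_sub, abs_mul, Real.abs_exp, Real.exp_neg, inv_mul_le_iff₀ (Real.exp_pos _),
      abs_sub_comm]
    refine h1.trans ?_
    rw [mul_comm]
    refine mul_le_mul_of_nonneg_left ?_ (Real.exp_pos _).le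
    rw [div_le_iff₀ (by positivity)]
    have h3 : (0 : ℝ) ≤ dist g g' := dist_nonneg
    push_cast
    nlinarith
  set g := hT.fixedPoint T with hg
  have hfix : T g = g := hT.fixedPoint_isFixedPt
  have hSg : ∀ t, 0 ≤ t → Real.exp (K * t ^ 2) * g t = S g t := by
    intro t ht
    have h1 : g t = Real.exp (-(K * t ^ 2)) * S g (|t|) := by
      conv_lhs => rw [← hfix]
      rfl
    rw [h1, abs_of_nonneg ht, ← mul_assoc, ← Real.exp_add]
    simp
  refine ⟨S g, fun s => -radialAverage n (N g) s, ⟨(hScont g).continuousOn,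
    (continuous_radialAverage n (hN g)).neg.continuousOn, by simp [radialAverage], ?_, ?_⟩,
    by simp [S]⟩
  · intro r _
    exact ((continuous_radialAverage n (hN g)).integral_hasStrictDerivAt 0 r).hasDerivAt.const_sub y
  · intro r hr
    refine (hasDerivAt_radialAverage n (hN g) hr).neg.congr_deriv ?_
    have : N g r = G r (S g r) := by rw [← hSg r hr.le]
    rw [this]
    ring

/-! ### Elementary consequences of the hypotheses on the nonlinearity -/

namespace GroundStateNonlinearity

variable {F F' Φ : ℝ → ℝ} {B L M : ℝ}

lemma abs_F_sub_le (hF : GroundStateNonlinearity F F' Φ B L M) (x y : ℝ) :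
    |F x - F y| ≤ L * |x - y| := by
  have := Convex.norm_image_sub_le_of_norm_hasDerivWithin_le (f := F) (f' := F') (s := univ)
    (fun x _ => (hF.hasDerivAt_F x).hasDerivWithinAt) (fun x _ => hF.abs_F'_le x) convex_univ
    (mem_univ y) (mem_univ x)
  exact this

lemma abs_F_le (hF : GroundStateNonlinearity F F' Φ B L M) (x : ℝ) : |F x| ≤ L * |x| := by
  simpa [hF.F_zero] using hF.abs_F_sub_le x 0

lemma continuous_F (hF : GroundStateNonlinearity F F' Φ B L M) : Continuous F :=
  continuous_iff_continuousAt.2 fun x => (hF.hasDerivAt_F x).continuousAt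

lemma continuous_Φ (hF : GroundStateNonlinearity F F' Φ B L M) : Continuous Φ :=
  continuous_iff_continuousAt.2 fun x => (hF.hasDerivAt_Φ x).continuousAt

lemma continuous_F' (hF : GroundStateNonlinearity F F' Φ B L M) : Continuous F' :=
  (LipschitzWith.of_dist_le_mul (K := ⟨M, hF.M_nonneg⟩) fun x y => by
    rw [Real.dist_eq, Real.dist_eq]; exact hF.abs_F'_sub_le x y).continuous

lemma abs_taylor_le (hF : GroundStateNonlinearity F F' Φ B L M) (x y : ℝ) :
    |F x - F y - F' y * (x - y)| ≤ M * |x - y| ^ 2 := by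
  have hd : ∀ t ∈ uIcc y x, HasDerivWithinAt (fun t => F t - F' y * t) (F' t - F' y)
      (uIcc y x) t := fun t _ =>
    (((hF.hasDerivAt_F t).sub ((hasDerivAt_id t).const_mul (F' y))).congr_deriv
      (by simp)).hasDerivWithinAt
  have := Convex.norm_image_sub_le_of_norm_hasDerivWithin_le (C := M * |x - y|) hd
    (fun t ht => (hF.abs_F'_sub_le t y).trans
      (mul_le_mul_of_nonneg_left (abs_sub_left_of_mem_uIcc ht) hF.M_nonneg))
    (convex_uIcc y x) left_mem_uIcc right_mem_uIcc
  rw [Real.norm_eq_abs, Real.norm_eq_abs] at this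
  calc _ = |F x - F' y * x - (F y - F' y * y)| := by congr 1; ring
    _ ≤ _ := this
    _ = _ := by ring

lemma F_eq_zero_of_Φ_eq (hF : GroundStateNonlinearity F F' Φ B L M) {x : ℝ} (h : Φ B ≤ Φ x) :
    F x = 0 :=
  IsLocalMax.hasDerivAt_eq_zero (Eventually.of_forall fun y => (hF.Φ_le y).trans h)
    (hF.hasDerivAt_Φ x)

lemma exists_F'_le (hF : GroundStateNonlinearity F F' Φ B L M) :
    ∃ δ m, 0 < δ ∧ δ < B ∧ 0 < m ∧ ∀ x, |x| ≤ δ → F' x ≤ -m := by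
  have h1 : ∀ᶠ x in 𝓝 (0 : ℝ), F' x < F' 0 / 2 :=
    (hF.continuous_F'.tendsto 0).eventually_lt_const (by linarith [hF.F'_zero_neg])
  obtain ⟨ε, hε, h2⟩ := Metric.eventually_nhds_iff.1 h1
  have hm : 0 < min ε B := lt_min hε hF.B_pos
  refine ⟨min ε B / 2, -(F' 0 / 2), by linarith, by linarith [min_le_right ε B],
    by linarith [hF.F'_zero_neg], fun x hx => ?_⟩
  have := h2 (y := x) (by rw [Real.dist_eq, sub_zero]; linarith [min_le_left ε B])
  linarith

lemma F_le_of_F'_le (hF : GroundStateNonlinearity F F' Φ B L M) {δ m : ℝ}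
    (h : ∀ x, |x| ≤ δ → F' x ≤ -m) {x y : ℝ} (hx : -δ ≤ x) (hxy : x ≤ y) (hy : y ≤ δ) :
    F y - F x ≤ -m * (y - x) := by
  have hanti : AntitoneOn (fun t => F t + m * t) (Icc x y) := by
    refine antitoneOn_of_hasDerivWithinAt_nonpos (convex_Icc x y) (f' := fun t => F' t + m)
      ((hF.continuous_F.add (by fun_prop)).continuousOn) (fun t _ => ?_) (fun t ht => ?_)
    · exact (((hF.hasDerivAt_F t).add ((hasDerivAt_id t).const_mul m)).congr_deriv
        (by simp)).hasDerivWithinAt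
    · rw [interior_Icc] at ht
      have := h t (abs_le.2 ⟨by linarith [ht.1], by linarith [ht.2]⟩)
      linarith
  have := hanti ⟨le_rfl, hxy⟩ ⟨hxy, le_rfl⟩ hxy
  simp only at this
  linarith

lemma abs_Φ_le (hF : GroundStateNonlinearity F F' Φ B L M) {x : ℝ} (hx : 0 ≤ x) :
    |Φ x| ≤ L * x * x := by
  have := Convex.norm_image_sub_le_of_norm_hasDerivWithin_le (f := Φ) (f' := F)
    (s := Icc 0 x) (C := L * x)
    (fun t _ => (hF.hasDerivAt_Φ t).hasDerivWithinAt)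
    (fun t ht => (hF.abs_F_le t).trans (by
      rw [abs_of_nonneg ht.1]
      exact mul_le_mul_of_nonneg_left ht.2 hF.L_nonneg)) (convex_Icc 0 x)
    (left_mem_Icc.2 hx) (right_mem_Icc.2 hx)
  simpa [hF.Φ_zero, abs_of_nonneg hx] using this

lemma exists_Φ_neg (hF : GroundStateNonlinearity F F' Φ B L M) :
    ∃ y, 0 < y ∧ y < B ∧ Φ y < 0 := by
  obtain ⟨δ, m, hδ, hδB, hm, h⟩ := hF.exists_F'_le
  refine ⟨δ, hδ, hδB, ?_⟩
  have hanti : StrictAntiOn Φ (Icc 0 δ) := by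
    refine strictAntiOn_of_deriv_neg (convex_Icc 0 δ) hF.continuous_Φ.continuousOn fun t ht => ?_
    rw [interior_Icc] at ht
    rw [(hF.hasDerivAt_Φ t).deriv]
    have := hF.F_le_of_F'_le h (x := 0) (y := t) (by linarith) ht.1.le ht.2.le
    rw [hF.F_zero] at this
    nlinarith [ht.1]
  have := hanti ⟨le_rfl, hδ.le⟩ ⟨hδ.le, le_rfl⟩ hδ
  rwa [hF.Φ_zero] at this

end GroundStateNonlinearity

/-! ### Energy and monotonicity -/

lemma hasDerivAt_pow_div (n : ℕ) {r : ℝ} (hr : 0 < r) :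
    HasDerivAt (fun r : ℝ => r ^ n) (n / r * r ^ n) r := by
  refine (hasDerivAt_pow n r).congr_deriv ?_
  rcases n with _ | n
  · simp
  · rw [Nat.add_sub_cancel]
    field_simp
    ring

/-- The mechanical energy `u'²/2 + Φ(u)`. -/
noncomputable def energy (Φ u p : ℝ → ℝ) (r : ℝ) : ℝ := p r ^ 2 / 2 + Φ (u r)

lemma le_sub_of_deriv_le {f f' : ℝ → ℝ} {R δ : ℝ} (hd : ∀ r, R ≤ r → HasDerivAt f (f' r) r)
    (hle : ∀ r, R ≤ r → f' r ≤ -δ) {r : ℝ} (hr : R ≤ r) : f r ≤ f R - δ * (r - R) := by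
  have hanti : AntitoneOn (fun t => f t + δ * t) (Ici R) := by
    have hd' : ∀ t, R ≤ t → HasDerivAt (fun t => f t + δ * t) (f' t + δ) t := fun t ht =>
      ((hd t ht).add ((hasDerivAt_id t).const_mul δ)).congr_deriv (by simp)
    refine antitoneOn_of_hasDerivWithinAt_nonpos (convex_Ici R) (f' := fun t => f' t + δ)
      (fun t ht => (hd' t ht).continuousAt.continuousWithinAt) (fun t ht => ?_) (fun t ht => ?_)
    · rw [interior_Ici] at ht
      exact (hd' t (le_of_lt ht)).hasDerivWithinAt
    · rw [interior_Ici] at ht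
      linarith [hle t (le_of_lt ht)]
  have := hanti self_mem_Ici hr hr
  simp only at this
  linarith

lemma tendsto_atBot_of_deriv_le {f f' : ℝ → ℝ} {δ : ℝ} (hδ : 0 < δ)
    (hd : ∀ᶠ r in atTop, HasDerivAt f (f' r) r) (hle : ∀ᶠ r in atTop, f' r ≤ -δ) :
    Tendsto f atTop atBot := by
  obtain ⟨R, hR⟩ := eventually_atTop.1 (hd.and hle)
  have h1 : Tendsto (fun r : ℝ => f R - δ * (r - R)) atTop atBot := by
    have : Tendsto (fun r : ℝ => r - R) atTop atTop := tendsto_atTop_add_const_right _ _ tendsto_id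
    have := tendsto_atBot_add_const_left atTop (f R)
      (tendsto_neg_atTop_atBot.comp (this.const_mul_atTop hδ))
    simpa [sub_eq_add_neg] using this
  refine tendsto_atBot_mono' _ ?_ h1
  filter_upwards [eventually_ge_atTop R] with r hr
  exact le_sub_of_deriv_le (fun r hr => (hR r hr).1) (fun r hr => (hR r hr).2) hr

lemma exists_tendsto_of_antitoneOn {f : ℝ → ℝ} {c : ℝ} (hf : AntitoneOn f (Ici 0))
    (hc : ∀ r, 0 ≤ r → c ≤ f r) : ∃ l, Tendsto f atTop (𝓝 l) ∧ c ≤ l ∧ ∀ r, 0 ≤ r → l ≤ f r := by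
  have hanti : Antitone fun r => f (max r 0) := fun x y hxy =>
    hf (mem_Ici.2 (le_max_right _ _)) (mem_Ici.2 (le_max_right _ _)) (max_le_max_right 0 hxy)
  have hbdd : BddBelow (range fun r => f (max r 0)) :=
    ⟨c, by rintro _ ⟨r, rfl⟩; exact hc _ (le_max_right _ _)⟩
  have ht := (tendsto_atTop_ciInf hanti hbdd).congr' (f₂ := f) (by
    filter_upwards [eventually_ge_atTop 0] with r hr
    rw [max_eq_left hr])
  refine ⟨_, ht, ge_of_tendsto ht ?_, fun r hr => le_of_tendsto ht ?_⟩
  · filter_upwards [eventually_ge_atTop 0] with r hr using hc r hr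
  · filter_upwards [eventually_ge_atTop r] with s hs using hf hr (hr.trans hs) hs

section Energy

variable {F F' Φ : ℝ → ℝ} {B L M : ℝ} {n : ℕ} {u p : ℝ → ℝ}

lemma hasDerivAt_energy (hF : GroundStateNonlinearity F F' Φ B L M)
    (h : RadialSolution n (fun _ x => F x) u p) {r : ℝ} (hr : 0 < r) :
    HasDerivAt (energy Φ u p) (-(n / r * p r ^ 2)) r := by
  have h1 := (((h.hasDerivAt_p r hr).pow 2).div_const 2).add
    ((hF.hasDerivAt_Φ (u r)).comp r (h.hasDerivAt_u r hr))
  refine h1.congr_deriv ?_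
  push_cast
  ring

lemma continuousOn_energy (hF : GroundStateNonlinearity F F' Φ B L M)
    (h : RadialSolution n (fun _ x => F x) u p) : ContinuousOn (energy Φ u p) (Ici 0) :=
  ((h.cont_p.pow 2).div_const 2).add (hF.continuous_Φ.comp_continuousOn h.cont_u)

lemma antitoneOn_energy (hF : GroundStateNonlinearity F F' Φ B L M)
    (h : RadialSolution n (fun _ x => F x) u p) : AntitoneOn (energy Φ u p) (Ici 0) := by
  refine antitoneOn_of_hasDerivWithinAt_nonpos (convex_Ici 0)
    (f' := fun r => -(n / r * p r ^ 2)) (continuousOn_energy hF h) (fun r hr => ?_)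
    (fun r hr => ?_)
  · rw [interior_Ici] at hr
    exact (hasDerivAt_energy hF h hr).hasDerivWithinAt
  · rw [interior_Ici] at hr
    have : (0 : ℝ) < r := hr
    have : 0 ≤ n / r * p r ^ 2 := by positivity
    linarith

lemma RadialSolution.unique_nonlin (hF : GroundStateNonlinearity F F' Φ B L M)
    (h : RadialSolution n (fun _ x => F x) u p) {u' p' : ℝ → ℝ}
    (h' : RadialSolution n (fun _ x => F x) u' p') (h0 : u 0 = u' 0) : EqOn u u' (Ici 0) :=
  h.unique hF.L_nonneg (fun _ _ x y => hF.abs_F_sub_le x y) h' h0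

/-- `r ^ n u'` decreases as long as `F(u) > 0`. -/
lemma deriv_neg_of_F_pos (h : RadialSolution n (fun _ x => F x) u p)
    {s : ℝ} (hs : 0 < s) (hFu : ∀ r, 0 < r → r < s → 0 < F (u r)) : p s < 0 := by
  have hanti : StrictAntiOn (fun r => r ^ n * p r) (Icc 0 s) := by
    refine strictAntiOn_of_deriv_neg (convex_Icc 0 s)
      ((Continuous.continuousOn (by fun_prop)).mul (h.cont_p.mono fun x hx => hx.1))
      fun r hr => ?_
    rw [interior_Icc] at hr
    have hd : HasDerivAt (fun r => r ^ n * p r) _ r :=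
      (hasDerivAt_pow_div n hr.1).mul (h.hasDerivAt_p r hr.1)
    rw [hd.deriv]
    have h1 := hFu r hr.1 hr.2
    have h2 := hr.1
    have : 0 < r ^ n * F (u r) := by positivity
    nlinarith
  have := hanti ⟨le_rfl, hs.le⟩ ⟨hs.le, le_rfl⟩ hs
  simp only [h.p_zero, mul_zero] at this
  exact (pos_iff_neg_of_mul_neg this).1 (by positivity)

/-- A solution starting in `(0, B)` decreases as long as it is positive with nonnegative
energy: at a first critical point the energy would force `F(u) > 0` up to that point. -/
lemma deriv_neg_of_energy_nonneg (hF : GroundStateNonlinearity F F' Φ B L M)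
    (h : RadialSolution n (fun _ x => F x) u p) (huB : u 0 < B) {T : ℝ}
    (hpos : ∀ r, 0 ≤ r → r < T → 0 < u r) (hE : ∀ r, 0 ≤ r → r < T → 0 ≤ energy Φ u p r) :
    ∀ r, 0 < r → r < T → p r < 0 := by
  intro r0 hr0 hr0T
  by_contra! hcon
  have hT : 0 < T := hr0.trans hr0T
  have hF0 : 0 < F (u 0) := by
    refine hF.F_pos_of_Φ_nonneg _ (hpos 0 le_rfl hT) huB ?_
    simpa [energy, h.p_zero] using hE 0 le_rfl hT
  obtain ⟨ε, hε, hFε⟩ : ∃ ε, 0 < ε ∧ ∀ r, 0 < r → r < ε → 0 < F (u r) := by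
    have h1 : ∀ᶠ r in 𝓝[≥] (0 : ℝ), 0 < F (u r) :=
      ((hF.continuous_F.comp_continuousOn h.cont_u) 0 self_mem_Ici).eventually_const_lt hF0
    obtain ⟨ε, hε, h2⟩ := mem_nhdsGE_iff_exists_Ico_subset.1 h1
    exact ⟨ε, hε, fun r h3 h4 => h2 ⟨h3.le, h4⟩⟩
  have hnegε : ∀ r, 0 < r → r ≤ ε → p r < 0 := fun r h1 h2 =>
    deriv_neg_of_F_pos h h1 fun t h3 h4 => hFε t h3 (h4.trans_le h2)
  have hεr0 : ε < r0 := by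
    by_contra! hc
    linarith [hnegε r0 hr0 hc]
  have hcont : ∀ {x}, ContinuousOn p (Icc ε x) := h.cont_p.mono fun x hx => hε.le.trans hx.1
  set S := {r ∈ Icc ε r0 | p r = 0} with hS
  have hSne : S.Nonempty := by
    obtain ⟨x, hx, hpx⟩ := intermediate_value_Icc hεr0.le hcont ⟨(hnegε ε hε le_rfl).le, hcon⟩
    exact ⟨x, hx, hpx⟩
  have hScl : IsClosed S := hcont.preimage_isClosed_of_isClosed isClosed_Icc isClosed_singleton
  have hSbdd : BddBelow S := ⟨ε, fun x hx => hx.1.1⟩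
  obtain ⟨⟨hs1, hs2⟩, hps⟩ := hScl.csInf_mem hSne hSbdd
  set s := sInf S with hs
  have hs0 : 0 < s := hε.trans_le hs1
  have hneg : ∀ r, 0 < r → r < s → p r < 0 := by
    intro r h1 h2
    by_contra! hc
    rcases le_or_gt r ε with h3 | h3
    · linarith [hnegε r h1 h3]
    · obtain ⟨x, hx, hpx⟩ := intermediate_value_Icc h3.le hcont ⟨(hnegε ε hε le_rfl).le, hc⟩
      have : s ≤ x := csInf_le hSbdd ⟨⟨hx.1, by linarith [hx.2]⟩, hpx⟩
      linarith [hx.2]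
  have hanti : StrictAntiOn u (Icc 0 s) := by
    refine strictAntiOn_of_deriv_neg (convex_Icc 0 s) (h.cont_u.mono fun x hx => hx.1)
      fun r hr => ?_
    rw [interior_Icc] at hr
    rw [(h.hasDerivAt_u r hr.1).deriv]
    exact hneg r hr.1 hr.2
  have hus0 := hpos s hs0.le (hs2.trans_lt hr0T)
  have husB : u s < u 0 := hanti ⟨le_rfl, hs0.le⟩ ⟨hs0.le, le_rfl⟩ hs0
  have hEs := hE s hs0.le (hs2.trans_lt hr0T)
  have hps' : p s = 0 := hps
  rw [energy, hps'] at hEs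
  have hFs : 0 < F (u s) := hF.F_pos_of_Φ_nonneg _ hus0 (husB.trans huB) (by simpa using hEs)
  have := deriv_neg_of_F_pos h hs0 fun r h1 h2 =>
    hF.F_pos_of_lt (u s) (u r) hus0 (hanti ⟨h1.le, h2.le⟩ ⟨hs0.le, le_rfl⟩ h2)
      ((hanti ⟨le_rfl, hs0.le⟩ ⟨h1.le, h2.le⟩ h1).trans huB) hFs.le
  linarith

/-- A positive decreasing solution tending to `0` with its derivative. -/
structure GroundState (n : ℕ) (F : ℝ → ℝ) (B : ℝ) (u p : ℝ → ℝ) : Prop where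
  sol : RadialSolution n (fun _ x => F x) u p
  zero_lt : u 0 < B
  pos : ∀ r, 0 ≤ r → 0 < u r
  deriv_neg : ∀ r, 0 < r → p r < 0
  tendsto_u : Tendsto u atTop (𝓝 0)
  tendsto_p : Tendsto p atTop (𝓝 0)

lemma tendsto_energy (hF : GroundStateNonlinearity F F' Φ B L M)
    (hu : Tendsto u atTop (𝓝 0)) (hp : Tendsto p atTop (𝓝 0)) :
    Tendsto (energy Φ u p) atTop (𝓝 0) := by
  have h := ((hp.pow 2).div_const 2).add ((hF.continuous_Φ.tendsto 0).comp hu)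
  rw [hF.Φ_zero, zero_pow two_ne_zero, zero_div, add_zero] at h
  exact h

lemma energy_nonneg_of_tendsto (hF : GroundStateNonlinearity F F' Φ B L M)
    (h : RadialSolution n (fun _ x => F x) u p)
    (hu : Tendsto u atTop (𝓝 0)) (hp : Tendsto p atTop (𝓝 0)) {r : ℝ} (hr : 0 ≤ r) :
    0 ≤ energy Φ u p r := by
  refine le_of_tendsto (tendsto_energy hF hu hp) ?_
  filter_upwards [eventually_ge_atTop r] with s hs
  exact antitoneOn_energy hF h hr (hr.trans hs) hs

/-- A positive solution that tends to `0` starts below the maximum point `B` of the potential: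
otherwise it would cross the value `B`, where the energy would be at least its initial value. -/
lemma groundState_of_pos (hF : GroundStateNonlinearity F F' Φ B L M)
    (h : RadialSolution n (fun _ x => F x) u p) (hpos : ∀ r, 0 ≤ r → 0 < u r)
    (hu : Tendsto u atTop (𝓝 0)) (hp : Tendsto p atTop (𝓝 0)) : GroundState n F B u p := by
  have huB : u 0 < B := by
    by_contra! hcon
    obtain ⟨R, hR0, hR⟩ : ∃ R, 0 ≤ R ∧ u R < B := by
      obtain ⟨R, hR⟩ := ((hu.eventually_lt_const hF.B_pos).and (eventually_ge_atTop 0)).exists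
      exact ⟨R, hR.2, hR.1⟩
    obtain ⟨x, hx, hux⟩ := intermediate_value_Icc' hR0 (h.cont_u.mono fun x hx => hx.1)
      (⟨hR.le, hcon⟩ : B ∈ Icc (u R) (u 0))
    have hE := antitoneOn_energy hF h self_mem_Ici hx.1 hx.1
    simp only [energy, hux, h.p_zero] at hE
    have hFu : F (u 0) = 0 := hF.F_eq_zero_of_Φ_eq (by nlinarith [sq_nonneg (p x)])
    have hc : RadialSolution n (fun _ x => F x) (fun _ => u 0) (fun _ => 0) :=
      ⟨continuousOn_const, continuousOn_const, rfl, fun r _ => hasDerivAt_const r _,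
        fun r _ => by simpa [hFu] using hasDerivAt_const r (0 : ℝ)⟩
    have := h.unique_nonlin hF hc rfl hR0
    simp only at this
    linarith
  exact ⟨h, huB, hpos, fun r hr => deriv_neg_of_energy_nonneg hF h huB (T := r + 1)
    (fun r hr _ => hpos r hr) (fun r hr _ => energy_nonneg_of_tendsto hF h hu hp hr) r hr
    (by linarith), hu, hp⟩

lemma u_pos_of_nonneg (hF : GroundStateNonlinearity F F' Φ B L M)
    (h : RadialSolution n (fun _ x => F x) u p) (hu0 : 0 < u 0) (hnn : ∀ r, 0 ≤ r → 0 ≤ u r) :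
    ∀ r, 0 ≤ r → 0 < u r := by
  intro r hr
  rcases hr.eq_or_lt with rfl | hr
  · exact hu0
  refine (hnn r hr.le).lt_of_ne' fun h0 => ?_
  refine h.deriv_ne_zero_of_eq_zero hF.L_nonneg (fun _ _ => hF.abs_F_le) hu0.ne' hr h0 ?_
  refine IsLocalMin.hasDerivAt_eq_zero ?_ (h.hasDerivAt_u r hr)
  filter_upwards [Ioi_mem_nhds hr] with x hx
  rw [h0]
  exact hnn x (le_of_lt hx)

/-- A solution starting in `(0, B)` that stays nonnegative and keeps a nonnegative energy is a
ground state. -/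
lemma groundState_of_nonneg (hF : GroundStateNonlinearity F F' Φ B L M)
    (h : RadialSolution n (fun _ x => F x) u p) (hu0 : 0 < u 0) (huB : u 0 < B)
    (hnn : ∀ r, 0 ≤ r → 0 ≤ u r) (hE : ∀ r, 0 ≤ r → 0 ≤ energy Φ u p r) :
    GroundState n F B u p := by
  have hpos := u_pos_of_nonneg hF h hu0 hnn
  have hneg : ∀ r, 0 < r → p r < 0 := fun r hr => deriv_neg_of_energy_nonneg hF h huB (T := r + 1)
    (fun r hr _ => hpos r hr) (fun r hr _ => hE r hr) r hr (by linarith)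
  have hanti : AntitoneOn u (Ici 0) := by
    refine antitoneOn_of_hasDerivWithinAt_nonpos (convex_Ici 0) (f' := p) h.cont_u
      (fun r hr => ?_) (fun r hr => ?_) <;> rw [interior_Ici] at hr
    · exact (h.hasDerivAt_u r hr).hasDerivWithinAt
    · exact (hneg r hr).le
  obtain ⟨l, hl, hl0, hle⟩ := exists_tendsto_of_antitoneOn hanti hnn
  obtain ⟨e, he, he0, -⟩ := exists_tendsto_of_antitoneOn (antitoneOn_energy hF h) hE
  have hΦl := (hF.continuous_Φ.tendsto l).comp hl
  have hp2 : Tendsto (fun r => p r ^ 2) atTop (𝓝 (2 * (e - Φ l))) := by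
    refine ((he.sub hΦl).const_mul 2).congr fun r => ?_
    simp only [energy, Function.comp]
    ring
  have hc0 : 0 ≤ 2 * (e - Φ l) := ge_of_tendsto' hp2 fun r => sq_nonneg _
  have hpos1 : ∀ᶠ r : ℝ in atTop, 0 < r := eventually_gt_atTop 0
  have hc : 2 * (e - Φ l) = 0 := by
    by_contra hne
    have hc1 : 0 < 2 * (e - Φ l) := hc0.lt_of_ne' hne
    set c := 2 * (e - Φ l) with hcdef
    have h1 := hp2.eventually_const_lt (show c / 4 < c by linarith)
    have hs : 0 < Real.sqrt (c / 4) := Real.sqrt_pos.2 (by linarith)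
    have h2 : Tendsto u atTop atBot := by
      refine tendsto_atBot_of_deriv_le hs (hpos1.mono fun r hr => h.hasDerivAt_u r hr) ?_
      filter_upwards [h1, hpos1] with r h3 h4
      have h5 := hneg r h4
      have h6 := Real.sq_sqrt (show 0 ≤ c / 4 by linarith)
      nlinarith
    exact not_tendsto_nhds_of_tendsto_atBot h2 l hl
  have hp : Tendsto p atTop (𝓝 0) := by
    rw [hc] at hp2
    have h1 := hp2.sqrt
    simp only [Real.sqrt_sq_eq_abs, Real.sqrt_zero] at h1
    exact (tendsto_zero_iff_abs_tendsto_zero p).2 h1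
  have hl0' : l = 0 := by
    by_contra hne
    have hlpos : 0 < l := hl0.lt_of_ne' hne
    have hFl : 0 < F l := hF.F_pos_of_Φ_nonneg l hlpos ((hle 0 le_rfl).trans_lt huB) (by linarith)
    have hnr : Tendsto (fun r : ℝ => (n : ℝ) / r) atTop (𝓝 0) :=
      tendsto_const_nhds.div_atTop tendsto_id
    have hd : Tendsto (fun r => -(n / r * p r) - F (u r)) atTop (𝓝 (-(0 * 0) - F l)) :=
      (hnr.mul hp).neg.sub ((hF.continuous_F.tendsto l).comp hl)
    have h1 := hd.eventually_le_const (show -(0 * 0) - F l < -(F l / 2) by linarith)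
    have h2 := tendsto_atBot_of_deriv_le (half_pos hFl)
      (hpos1.mono fun r hr => h.hasDerivAt_p r hr) h1
    exact not_tendsto_nhds_of_tendsto_atBot h2 0 hp
  exact ⟨h, huB, hpos, hneg, hl0' ▸ hl, hp⟩

/-! ### Exponential decay of ground states -/

lemma GroundState.strictAntiOn (g : GroundState n F B u p) : StrictAntiOn u (Ici 0) := by
  refine strictAntiOn_of_deriv_neg (convex_Ici 0) g.sol.cont_u fun r hr => ?_
  rw [interior_Ici] at hr
  rw [(g.sol.hasDerivAt_u r hr).deriv]
  exact g.deriv_neg r hr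

lemma GroundState.lt_B (g : GroundState n F B u p) {r : ℝ} (hr : 0 ≤ r) : u r < B :=
  (g.strictAntiOn.antitoneOn self_mem_Ici hr hr).trans_lt g.zero_lt

lemma GroundState.exp_decay (hF : GroundStateNonlinearity F F' Φ B L M)
    (g : GroundState n F B u p) :
    ∃ C κ, 0 < κ ∧ ∀ᶠ r in atTop, u r ≤ C * Real.exp (-(κ * r)) ∧
      |p r| ≤ C * Real.exp (-(κ * r)) := by
  obtain ⟨δ, m, hδ, -, hm, hF'⟩ := hF.exists_F'_le
  obtain ⟨R, hR⟩ := eventually_atTop.1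
    ((g.tendsto_u.eventually_le_const hδ).and (eventually_gt_atTop 0))
  have hR0 : 0 < R := (hR R le_rfl).2
  have hFu : ∀ r, R ≤ r → F (u r) ≤ -(m * u r) := by
    intro r hr
    have := hF.F_le_of_F'_le hF' (x := 0) (y := u r) (by linarith) (g.pos r (hR r hr).2.le).le
      (hR r hr).1
    rw [hF.F_zero] at this
    linarith
  set κ := Real.sqrt m with hκ
  have hκ0 : 0 < κ := Real.sqrt_pos.2 hm
  have hκ2 : κ ^ 2 = m := Real.sq_sqrt hm.le
  have hd : ∀ r, R ≤ r → HasDerivAt (fun r => p r ^ 2 - m * u r ^ 2)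
      (2 * p r * (-(n / r * p r) - F (u r)) - m * (2 * u r * p r)) r := by
    intro r hr
    have hr0 := (hR r hr).2
    refine (((g.sol.hasDerivAt_p r hr0).pow 2).sub
      (((g.sol.hasDerivAt_u r hr0).pow 2).const_mul m)).congr_deriv ?_
    simp
  have hanti : AntitoneOn (fun r => p r ^ 2 - m * u r ^ 2) (Ici R) := by
    refine antitoneOn_of_hasDerivWithinAt_nonpos (convex_Ici R)
      (fun r hr => (hd r hr).continuousAt.continuousWithinAt)
      (fun r hr => (hd r ?_).hasDerivWithinAt) (fun r hr => ?_) <;> rw [interior_Ici] at hr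
    · exact le_of_lt hr
    · have hr' : R ≤ r := le_of_lt hr
      have hr0 := (hR r hr').2
      have h1 := hFu r hr'
      have h2 := g.deriv_neg r hr0
      have h3 : 0 ≤ n / r * p r ^ 2 := by positivity
      nlinarith
  have hlim : Tendsto (fun r => p r ^ 2 - m * u r ^ 2) atTop (𝓝 0) := by
    simpa using (g.tendsto_p.pow 2).sub ((g.tendsto_u.pow 2).const_mul m)
  have hle : ∀ r, R ≤ r → p r + κ * u r ≤ 0 := by
    intro r hr
    have h1 : 0 ≤ p r ^ 2 - m * u r ^ 2 := by
      refine le_of_tendsto hlim ?_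
      filter_upwards [eventually_ge_atTop r] with s hs
      exact hanti hr (hr.trans hs) hs
    have h2 := g.deriv_neg r (hR r hr).2
    have h3 := g.pos r (hR r hr).2.le
    have h4 : 0 < κ * u r := by positivity
    nlinarith
  have hd2 : ∀ r, R ≤ r → HasDerivAt (fun r => u r * Real.exp (κ * r))
      (p r * Real.exp (κ * r) + u r * (Real.exp (κ * r) * κ)) r := by
    intro r hr
    have e1 : HasDerivAt (fun r => Real.exp (κ * r)) (Real.exp (κ * r) * κ) r := by
      simpa using ((hasDerivAt_id r).const_mul κ).exp
    exact (g.sol.hasDerivAt_u r (hR r hr).2).mul e1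
  have hanti2 : AntitoneOn (fun r => u r * Real.exp (κ * r)) (Ici R) := by
    refine antitoneOn_of_hasDerivWithinAt_nonpos (convex_Ici R)
      (fun r hr => (hd2 r hr).continuousAt.continuousWithinAt)
      (fun r hr => (hd2 r ?_).hasDerivWithinAt) (fun r hr => ?_) <;> rw [interior_Ici] at hr
    · exact le_of_lt hr
    · have h1 := hle r (le_of_lt hr)
      nlinarith [Real.exp_pos (κ * r)]
  set C := u R * Real.exp (κ * R) with hC
  have hC0 : 0 < C := mul_pos (g.pos R hR0.le) (Real.exp_pos _)
  have hu : ∀ r, R ≤ r → u r ≤ C * Real.exp (-(κ * r)) := by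
    intro r hr
    have := hanti2 self_mem_Ici hr hr
    simp only at this
    rwa [Real.exp_neg, ← div_eq_mul_inv, le_div_iff₀ (Real.exp_pos _)]
  have hpm : MonotoneOn p (Ici R) := by
    refine monotoneOn_of_hasDerivWithinAt_nonneg (convex_Ici R)
      (fun r hr => (g.sol.hasDerivAt_p r (hR r hr).2).continuousAt.continuousWithinAt)
      (fun r hr => (g.sol.hasDerivAt_p r ?_).hasDerivWithinAt) (fun r hr => ?_) <;>
      rw [interior_Ici] at hr
    · exact hR0.trans hr
    · have hr0 : 0 < r := hR0.trans hr
      have h1 := hFu r (le_of_lt hr)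
      have h2 := g.deriv_neg r hr0
      have h3 := g.pos r hr0.le
      have h4 : 0 ≤ n / r * (-p r) := by
        have : 0 ≤ -p r := by linarith
        positivity
      nlinarith
  refine ⟨C * Real.exp κ, κ, hκ0, ?_⟩
  filter_upwards [eventually_ge_atTop (R + 1)] with r hr
  have h1 := hu (r - 1) (by linarith)
  have e : C * Real.exp κ * Real.exp (-(κ * r)) = C * Real.exp (-(κ * (r - 1))) := by
    rw [mul_assoc, ← Real.exp_add]; congr 2; ring
  rw [e]
  refine ⟨(g.strictAntiOn.antitoneOn (by simp; linarith) (by simp; linarith)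
    (by linarith)).trans h1, ?_⟩
  obtain ⟨x, hx, hpx⟩ := exists_hasDerivAt_eq_slope u p (show r - 1 < r by linarith)
    (g.sol.cont_u.mono fun x hx => by have := hx.1; simp; linarith)
    (fun x hx => g.sol.hasDerivAt_u x (by linarith [hx.1]))
  have h2 := hpm (show R ≤ x by linarith [hx.1]) (show R ≤ r by linarith) hx.2.le
  have h3 := g.pos r (by linarith)
  have h4 := g.deriv_neg r (by linarith)
  rw [abs_of_neg h4]
  rw [sub_sub_cancel, div_one] at hpx
  linarith

lemma tendsto_pow_mul_of_exp_decay {f : ℝ → ℝ} {C κ : ℝ} (hκ : 0 < κ)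
    (hf : ∀ᶠ r in atTop, |f r| ≤ C * Real.exp (-(κ * r))) (k : ℕ) :
    Tendsto (fun r => r ^ k * f r) atTop (𝓝 0) := by
  have h1 := (Real.tendsto_pow_mul_exp_neg_atTop_nhds_zero k).comp
    (tendsto_id.const_mul_atTop hκ)
  have h2 := h1.const_mul (C / κ ^ k)
  rw [mul_zero] at h2
  refine squeeze_zero_norm' ?_ h2
  filter_upwards [hf, eventually_ge_atTop 0] with r h3 h4
  rw [norm_mul, norm_pow, Real.norm_eq_abs, Real.norm_eq_abs, abs_of_nonneg h4]
  have : C / κ ^ k * ((κ * r) ^ k * Real.exp (-(κ * r))) =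
      r ^ k * (C * Real.exp (-(κ * r))) := by
    rw [mul_pow]
    field_simp
  simp only [Function.comp, id]
  rw [this]
  exact mul_le_mul_of_nonneg_left h3 (by positivity)

lemma GroundState.tendsto_pow_mul_u (hF : GroundStateNonlinearity F F' Φ B L M)
    (g : GroundState n F B u p) (k : ℕ) : Tendsto (fun r => r ^ k * u r) atTop (𝓝 0) := by
  obtain ⟨C, κ, hκ, h⟩ := g.exp_decay hF
  refine tendsto_pow_mul_of_exp_decay hκ (C := C) ?_ k
  filter_upwards [h, eventually_ge_atTop 0] with r h1 h2
  rw [abs_of_pos (g.pos r h2)]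
  exact h1.1

lemma GroundState.tendsto_pow_mul_p (hF : GroundStateNonlinearity F F' Φ B L M)
    (g : GroundState n F B u p) (k : ℕ) : Tendsto (fun r => r ^ k * p r) atTop (𝓝 0) := by
  obtain ⟨C, κ, hκ, h⟩ := g.exp_decay hF
  exact tendsto_pow_mul_of_exp_decay hκ (C := C) (h.mono fun r h1 => h1.2) k

end Energy

/-! ### Exponential divergence from a Wronskian -/

section Divergence

variable {F F' Φ : ℝ → ℝ} {B L M : ℝ} {n : ℕ} {u p v q : ℝ → ℝ}

/-- If from `R` on `v < 0` and the coefficient of the equation is at most `-m < 0`, and if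
`v'(R) < 0`, then `v` and `v'` tend to `-∞` exponentially fast. -/
lemma exponential_of_neg {c : ℝ → ℝ} {R m : ℝ} (hR : 0 < R) (hm : 0 < m)
    (hv : RadialSolution n (fun r x => c r * x) v q) (hc : ∀ r, R ≤ r → c r ≤ -m)
    (hvneg : ∀ r, R ≤ r → v r < 0) (hqR : q R < 0) :
    TendsToNegInftyExponentially v ∧ TendsToNegInftyExponentially q := by
  have hpos : ∀ r, R ≤ r → 0 < r := fun r hr => hR.trans_le hr
  have hqneg : ∀ r, R ≤ r → q r < 0 := by
    intro r hr
    have hd : ∀ r, R ≤ r → HasDerivAt (fun r => r ^ n * q r) (-(r ^ n * (c r * v r))) r := by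
      intro r hr
      refine ((hasDerivAt_pow_div n (hpos r hr)).mul
        (hv.hasDerivAt_p r (hpos r hr))).congr_deriv ?_
      ring
    have hanti : AntitoneOn (fun r => r ^ n * q r) (Ici R) := by
      refine antitoneOn_of_hasDerivWithinAt_nonpos (convex_Ici R)
        (fun r hr => (hd r hr).continuousAt.continuousWithinAt)
        (fun r hr => (hd r ?_).hasDerivWithinAt) (fun r hr => ?_) <;> rw [interior_Ici] at hr
      · exact le_of_lt hr
      · have h1 := hc r (le_of_lt hr)
        have h2 := hvneg r (le_of_lt hr)
        have h3 := hpos r (le_of_lt hr)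
        have h4 : 0 < c r * v r := mul_pos_of_neg_of_neg (by linarith) h2
        have : 0 < r ^ n * (c r * v r) := by positivity
        linarith
    have h1 := hanti self_mem_Ici hr hr
    simp only at h1
    have h2 : R ^ n * q R < 0 := mul_neg_of_pos_of_neg (by positivity) hqR
    have h3 : 0 < r ^ n := pow_pos (hpos r hr) n
    by_contra! hcon
    have : 0 ≤ r ^ n * q r := by positivity
    linarith
  have hvanti : AntitoneOn v (Ici R) := by
    refine antitoneOn_of_hasDerivWithinAt_nonpos (convex_Ici R)
      (fun r hr => (hv.hasDerivAt_u r (hpos r hr)).continuousAt.continuousWithinAt)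
      (fun r hr => (hv.hasDerivAt_u r (hpos r ?_)).hasDerivWithinAt) (fun r hr => ?_) <;>
      rw [interior_Ici] at hr
    · exact le_of_lt hr
    · exact (hqneg r (le_of_lt hr)).le
  set ε : ℝ := n / R with hε
  have hε0 : 0 ≤ ε := by positivity
  -- A rate `κ` slow enough for the damping, which is at most `ε`.
  obtain ⟨κ, hκ, hκm⟩ : ∃ κ : ℝ, 0 < κ ∧ κ * (κ + ε) ≤ m := by
    refine ⟨min 1 (m / (1 + ε)), by positivity, ?_⟩
    have h1 : min 1 (m / (1 + ε)) ≤ 1 := min_le_left _ _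
    have h2 : min 1 (m / (1 + ε)) ≤ m / (1 + ε) := min_le_right _ _
    have h3 : 0 < min 1 (m / (1 + ε)) := by positivity
    calc min 1 (m / (1 + ε)) * (min 1 (m / (1 + ε)) + ε) ≤ m / (1 + ε) * (1 + ε) := by
          gcongr
      _ = m := by field_simp
  have hd : ∀ r, R ≤ r → HasDerivAt (fun r => Real.exp ((ε + κ) * r) * (q r - κ * v r))
      (Real.exp ((ε + κ) * r) * (ε + κ) * (q r - κ * v r) +
        Real.exp ((ε + κ) * r) * (-(n / r * q r) - c r * v r - κ * q r)) r := by
    intro r hr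
    have e1 : HasDerivAt (fun r => Real.exp ((ε + κ) * r))
        (Real.exp ((ε + κ) * r) * (ε + κ)) r := by
      simpa using ((hasDerivAt_id r).const_mul (ε + κ)).exp
    exact e1.mul ((hv.hasDerivAt_p r (hpos r hr)).sub
      ((hv.hasDerivAt_u r (hpos r hr)).const_mul κ))
  have hanti : AntitoneOn (fun r => Real.exp ((ε + κ) * r) * (q r - κ * v r)) (Ici R) := by
    refine antitoneOn_of_hasDerivWithinAt_nonpos (convex_Ici R)
      (fun r hr => (hd r hr).continuousAt.continuousWithinAt)
      (fun r hr => (hd r ?_).hasDerivWithinAt) (fun r hr => ?_) <;> rw [interior_Ici] at hr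
    · exact le_of_lt hr
    · have hr' : R ≤ r := le_of_lt hr
      have h1 : (n : ℝ) / r * (-q r) ≤ ε * (-q r) := by
        have := hqneg r hr'
        refine mul_le_mul_of_nonneg_right ?_ (by linarith)
        rw [hε]
        gcongr
      have h2 : m * (-v r) ≤ (-c r) * (-v r) :=
        mul_le_mul_of_nonneg_right (by linarith [hc r hr']) (by linarith [hvneg r hr'])
      have h3 : κ * (κ + ε) * (-v r) ≤ m * (-v r) :=
        mul_le_mul_of_nonneg_right hκm (by linarith [hvneg r hr'])
      have h4 : (ε + κ) * (q r - κ * v r) + (-(n / r * q r) - c r * v r - κ * q r) ≤ 0 := by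
        nlinarith
      have h5 := Real.exp_pos ((ε + κ) * r)
      nlinarith
  set A := Real.exp ((ε + κ) * R) * (q R - κ * v R) with hA
  have hsmall : Tendsto (fun r => A * Real.exp (-((ε + κ) * r))) atTop (𝓝 0) := by
    have h1 : Tendsto (fun r : ℝ => -((ε + κ) * r)) atTop atBot :=
      tendsto_neg_atTop_atBot.comp (tendsto_id.const_mul_atTop (by positivity))
    simpa using (Real.tendsto_exp_atBot.comp h1).const_mul A
  have hvR := hvneg R le_rfl
  obtain ⟨R', hR'⟩ := eventually_atTop.1 ((hsmall.eventually_le_const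
    (show 0 < κ / 2 * (-v R) by have : 0 < -v R := by linarith
                                positivity)).and (eventually_ge_atTop R))
  have hRR' : R ≤ R' := (hR' R' le_rfl).2
  have hqv : ∀ r, R' ≤ r → q r ≤ κ / 2 * v r := by
    intro r hr
    obtain ⟨h1, h2⟩ := hR' r hr
    have h3 := hanti self_mem_Ici h2 h2
    have h4 := hvanti self_mem_Ici h2 h2
    simp only [← hA] at h3
    have h5 : q r - κ * v r ≤ A * Real.exp (-((ε + κ) * r)) := by
      rw [Real.exp_neg, ← div_eq_mul_inv, le_div_iff₀ (Real.exp_pos _)]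
      linarith
    nlinarith
  have hd2 : ∀ r, R' ≤ r → HasDerivAt (fun r => v r * Real.exp (-(κ / 2 * r)))
      (q r * Real.exp (-(κ / 2 * r)) + v r * (Real.exp (-(κ / 2 * r)) * (-(κ / 2)))) r := by
    intro r hr
    have e1 : HasDerivAt (fun r => Real.exp (-(κ / 2 * r)))
        (Real.exp (-(κ / 2 * r)) * (-(κ / 2))) r := by
      simpa using ((hasDerivAt_id r).const_mul (κ / 2)).neg.exp
    exact (hv.hasDerivAt_u r (hpos r (hRR'.trans hr))).mul e1
  have hanti2 : AntitoneOn (fun r => v r * Real.exp (-(κ / 2 * r))) (Ici R') := by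
    refine antitoneOn_of_hasDerivWithinAt_nonpos (convex_Ici R')
      (fun r hr => (hd2 r hr).continuousAt.continuousWithinAt)
      (fun r hr => (hd2 r ?_).hasDerivWithinAt) (fun r hr => ?_) <;> rw [interior_Ici] at hr
    · exact le_of_lt hr
    · have h1 := hqv r (le_of_lt hr)
      nlinarith [Real.exp_pos (-(κ / 2 * r))]
  set C := -(v R' * Real.exp (-(κ / 2 * R'))) with hC
  have hC0 : 0 < C := by
    have := mul_pos (show 0 < -v R' by linarith [hvneg R' hRR']) (Real.exp_pos (-(κ / 2 * R')))
    linarith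
  have hvle : ∀ r, R' ≤ r → v r ≤ -(C * Real.exp (κ / 2 * r)) := by
    intro r hr
    have h1 := hanti2 self_mem_Ici hr hr
    simp only at h1
    rw [Real.exp_neg (κ / 2 * r), ← div_eq_mul_inv, div_le_iff₀ (Real.exp_pos _)] at h1
    linarith
  refine ⟨⟨C, hC0, κ / 2, by positivity, ?_⟩, ⟨κ / 2 * C, by positivity, κ / 2, by positivity, ?_⟩⟩
  · filter_upwards [eventually_ge_atTop R'] with r hr using hvle r hr
  · filter_upwards [eventually_ge_atTop R'] with r hr
    have h1 := hvle r hr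
    have h2 := hqv r hr
    nlinarith

/-- Sturm comparison: if `f < 0` is small at infinity and the Wronskian of `f` and `v` stays
below a negative constant, then `v / f` has large derivative, so `v` is eventually negative. -/
lemma eventually_neg_of_wronskian {f f' : ℝ → ℝ} {δ : ℝ} (hδ : 0 < δ)
    (hf : ∀ᶠ r in atTop, f r < 0) (hfd : ∀ᶠ r in atTop, HasDerivAt f (f' r) r)
    (hvd : ∀ᶠ r in atTop, HasDerivAt v (q r) r)
    (hW : ∀ᶠ r in atTop, r ^ n * (f' r * v r - f r * q r) ≤ -δ)
    (hf0 : Tendsto f atTop (𝓝 0)) (hfn : Tendsto (fun r => r ^ n * f r) atTop (𝓝 0)) :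
    ∀ᶠ r in atTop, v r < 0 := by
  have h2 : Tendsto (fun r => r ^ n * f r * f r) atTop (𝓝 0) := by simpa using hfn.mul hf0
  have h3 : Tendsto (fun r => -(v r / f r)) atTop atBot := by
    refine tendsto_atBot_of_deriv_le one_pos
      (f' := fun r => -((q r * f r - v r * f' r) / f r ^ 2)) ?_ ?_
    · filter_upwards [hf, hfd, hvd] with r e1 e2 e3 using (e3.div e2 e1.ne).neg
    · filter_upwards [hf, hW, h2.eventually_le_const hδ, eventually_gt_atTop 0] with r e1 e2 e3 e4
      have e5 : 0 < r ^ n := pow_pos e4 n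
      have e6 : 0 < f r ^ 2 := sq_pos_of_neg e1
      rw [neg_le_neg_iff, le_div_iff₀ e6, one_mul]
      refine le_of_mul_le_mul_left ?_ e5
      nlinarith
  filter_upwards [h3.eventually_lt_atBot 0, hf] with r e1 e2
  by_contra! hcon
  have := div_nonpos_of_nonneg_of_nonpos hcon e2.le
  linarith

/-- A solution `v` whose Wronskian with a negative rapidly decreasing function `f` stays below a
negative constant diverges exponentially: if it did not, it would be bounded and nondecreasing,
and the Wronskian would be asymptotically nonnegative. -/
lemma exponential_of_wronskian (hF : GroundStateNonlinearity F F' Φ B L M)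
    (g : GroundState n F B u p) (hv : RadialSolution n (fun r x => F' (u r) * x) v q)
    {f f' : ℝ → ℝ} {δ : ℝ} (hδ : 0 < δ)
    (hf : ∀ᶠ r in atTop, f r < 0) (hfd : ∀ᶠ r in atTop, HasDerivAt f (f' r) r)
    (hW : ∀ᶠ r in atTop, r ^ n * (f' r * v r - f r * q r) ≤ -δ)
    (hf0 : Tendsto f atTop (𝓝 0)) (hfn : Tendsto (fun r => r ^ n * f r) atTop (𝓝 0))
    (hfn' : Tendsto (fun r => r ^ n * f' r) atTop (𝓝 0)) :
    TendsToNegInftyExponentially v ∧ TendsToNegInftyExponentially q := by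
  have hvd : ∀ᶠ r in atTop, HasDerivAt v (q r) r := by
    filter_upwards [eventually_gt_atTop 0] with r hr using hv.hasDerivAt_u r hr
  have hvneg := eventually_neg_of_wronskian hδ hf hfd hvd hW hf0 hfn
  obtain ⟨η, m, hη, -, hm, hF'⟩ := hF.exists_F'_le
  have hu := g.tendsto_u.abs.eventually_le_const (by simpa using hη)
  obtain ⟨R, hR⟩ := eventually_atTop.1 (hvneg.and (hu.and (eventually_gt_atTop 0)))
  have hR0 : 0 < R := (hR R le_rfl).2.2
  by_cases hq : ∃ r, R ≤ r ∧ q r < 0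
  · obtain ⟨r, hr, hqr⟩ := hq
    exact exponential_of_neg (hR r hr).2.2 hm hv (fun s hs => hF' _ (hR s (hr.trans hs)).2.1)
      (fun s hs => (hR s (hr.trans hs)).1) hqr
  · push Not at hq
    exfalso
    have hmono : MonotoneOn v (Ici R) := by
      refine monotoneOn_of_hasDerivWithinAt_nonneg (convex_Ici R)
        (fun r hr => (hv.hasDerivAt_u r (hR r hr).2.2).continuousAt.continuousWithinAt)
        (fun r hr => (hv.hasDerivAt_u r ?_).hasDerivWithinAt) (fun r hr => ?_) <;>
        rw [interior_Ici] at hr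
      · exact hR0.trans hr
      · exact hq r (le_of_lt hr)
    have hlow : Tendsto (fun r => r ^ n * f' r * v r) atTop (𝓝 0) := by
      refine hfn'.zero_mul_isBoundedUnder_le ⟨-v R, ?_⟩
      rw [eventually_map]
      filter_upwards [eventually_ge_atTop R] with r hr
      have h1 := hmono self_mem_Ici hr hr
      have h2 := (hR r hr).1
      simp only [Function.comp, Real.norm_eq_abs, abs_of_neg h2]
      linarith
    obtain ⟨r, h1, h2, h3, h4⟩ := ((hlow.eventually_const_lt (show -δ < 0 by linarith)).and
      (hW.and (hf.and (eventually_ge_atTop R)))).exists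
    have h5 : 0 < r ^ n := pow_pos (hR r h4).2.2 n
    have h6 := hq r h4
    have h7 : 0 ≤ r ^ n * (-f r * q r) := by
      have : 0 < -f r := by linarith
      positivity
    nlinarith

end Divergence

/-! ### The linearized equation at a ground state -/

section Linearized

variable {F F' Φ : ℝ → ℝ} {B L M : ℝ} {n : ℕ} {u p v q : ℝ → ℝ}

lemma GroundState.F_zero_pos (hF : GroundStateNonlinearity F F' Φ B L M)
    (g : GroundState n F B u p) : 0 < F (u 0) := by
  refine hF.F_pos_of_Φ_nonneg _ (g.pos 0 le_rfl) g.zero_lt ?_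
  have := energy_nonneg_of_tendsto hF g.sol g.tendsto_u g.tendsto_p le_rfl
  simpa [energy, g.sol.p_zero] using this

lemma GroundState.tendsto_pow_mul_F (hF : GroundStateNonlinearity F F' Φ B L M)
    (g : GroundState n F B u p) (k : ℕ) : Tendsto (fun r => r ^ k * F (u r)) atTop (𝓝 0) := by
  refine squeeze_zero_norm' (a := fun r => L * (r ^ k * u r)) ?_
    (by simpa using (g.tendsto_pow_mul_u hF k).const_mul L)
  filter_upwards [eventually_ge_atTop 0] with r hr
  have h1 := hF.abs_F_le (u r)
  rw [abs_of_pos (g.pos r hr)] at h1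
  have h2 : 0 ≤ r ^ k := pow_nonneg hr k
  rw [norm_mul, norm_pow, Real.norm_eq_abs, Real.norm_eq_abs, abs_of_nonneg hr]
  calc r ^ k * |F (u r)| ≤ r ^ k * (L * u r) := by gcongr
    _ = _ := by ring

/-- In dimension one the Wronskian of `u'` and `v` is the constant `-F(u(0))`. -/
lemma linearized_exponential_of_zero (hF : GroundStateNonlinearity F F' Φ B L M)
    (g : GroundState 0 F B u p) (hv : RadialSolution 0 (fun r x => F' (u r) * x) v q)
    (hv0 : v 0 = 1) :
    TendsToNegInftyExponentially v ∧ TendsToNegInftyExponentially q := by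
  have hd : ∀ r, 0 < r → HasDerivAt (fun r => -F (u r) * v r - p r * q r) 0 r := by
    intro r hr
    have h1 := ((((hF.hasDerivAt_F (u r)).comp r (g.sol.hasDerivAt_u r hr)).neg).mul
      (hv.hasDerivAt_u r hr)).sub ((g.sol.hasDerivAt_p r hr).mul (hv.hasDerivAt_p r hr))
    refine h1.congr_deriv ?_
    simp
    ring
  have hanti : AntitoneOn (fun r => -F (u r) * v r - p r * q r) (Ici 0) := by
    refine antitoneOn_of_hasDerivWithinAt_nonpos (convex_Ici 0) (f' := fun _ => 0)
      (((hF.continuous_F.comp_continuousOn g.sol.cont_u).neg.mul hv.cont_u).sub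
        (g.sol.cont_p.mul hv.cont_p)) (fun r hr => (hd r ?_).hasDerivWithinAt) (fun r hr => le_rfl)
    rwa [interior_Ici] at hr
  have hpos : ∀ᶠ r : ℝ in atTop, 0 < r := eventually_gt_atTop 0
  refine exponential_of_wronskian hF g hv (f := p) (f' := fun r => -F (u r)) (g.F_zero_pos hF)
    (hpos.mono g.deriv_neg) ?_ ?_ g.tendsto_p (by simpa using g.tendsto_p) ?_
  · filter_upwards [hpos] with r hr
    refine (g.sol.hasDerivAt_p r hr).congr_deriv ?_
    simp
  · filter_upwards [hpos] with r hr
    have := hanti self_mem_Ici hr.le hr.le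
    simp only [hv0, g.sol.p_zero] at this
    linarith
  · simpa using (g.tendsto_pow_mul_F hF 0).neg

lemma deriv_nonpos_of_left {f : ℝ → ℝ} {c x y : ℝ} (h : HasDerivAt f c x) (hx : f x = 0)
    (hyx : y < x) (hf : ∀ t, y < t → t < x → 0 ≤ f t) : c ≤ 0 := by
  have h1 : Tendsto (slope f x) (𝓝[<] x) (𝓝 c) :=
    (hasDerivAt_iff_tendsto_slope.1 h).mono_left (nhdsWithin_mono _ fun t ht => ne_of_lt ht)
  refine le_of_tendsto h1 ?_
  filter_upwards [Ioo_mem_nhdsLT hyx] with t ht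
  rw [slope_def_field, hx, sub_zero]
  exact div_nonpos_of_nonneg_of_nonpos (hf t ht.1 ht.2) (by linarith [ht.2])

/-- The first zero of a continuous function that is positive at `a` and not at `b`. -/
lemma exists_first_zero {f : ℝ → ℝ} {a b : ℝ} (hab : a ≤ b) (hf : ContinuousOn f (Icc a b))
    (ha : 0 < f a) (hb : f b ≤ 0) :
    ∃ c, a < c ∧ c ≤ b ∧ f c = 0 ∧ ∀ t, a ≤ t → t < c → 0 < f t := by
  set S := {r ∈ Icc a b | f r = 0} with hS
  have hSne : S.Nonempty := by
    obtain ⟨x, hx, hfx⟩ := intermediate_value_Icc' hab hf ⟨hb, ha.le⟩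
    exact ⟨x, hx, hfx⟩
  have hScl : IsClosed S := hf.preimage_isClosed_of_isClosed isClosed_Icc isClosed_singleton
  have hSbdd : BddBelow S := ⟨a, fun x hx => hx.1.1⟩
  obtain ⟨⟨hc1, hc2⟩, hfc⟩ := hScl.csInf_mem hSne hSbdd
  have hfc' : f (sInf S) = 0 := hfc
  refine ⟨sInf S, hc1.lt_of_ne fun h => ?_, hc2, hfc', fun t h1 h2 => ?_⟩
  · rw [← h] at hfc'; linarith
  · by_contra! hcon
    obtain ⟨x, hx, hfx⟩ := intermediate_value_Icc' h1
      (hf.mono fun y hy => ⟨hy.1, hy.2.trans (h2.le.trans hc2)⟩) ⟨hcon, ha.le⟩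
    have : sInf S ≤ x := csInf_le hSbdd ⟨⟨hx.1, by linarith [hx.2]⟩, hfx⟩
    linarith [hx.2]

/-- In dimension at least two `v` vanishes, by comparison with `u'`. -/
lemma exists_linearized_nonpos (hF : GroundStateNonlinearity F F' Φ B L M)
    (g : GroundState (n + 1) F B u p)
    (hv : RadialSolution (n + 1) (fun r x => F' (u r) * x) v q) :
    ∃ r, 0 ≤ r ∧ v r ≤ 0 := by
  by_contra! hvpos
  set W : ℝ → ℝ := fun r => r ^ (n + 1) * (-F (u r) * v r - p r * q r) -
    (n + 1) * r ^ n * p r * v r with hWdef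
  have hd : ∀ r, 0 < r → HasDerivAt W ((n + 1) / r ^ 2 * r ^ (n + 1) * p r * v r) r := by
    intro r hr
    have hFu := (hF.hasDerivAt_F (u r)).comp r (g.sol.hasDerivAt_u r hr)
    have hvr := hv.hasDerivAt_u r hr
    have hpr := g.sol.hasDerivAt_p r hr
    have h1 := ((hasDerivAt_pow_div (n + 1) hr).mul
      ((hFu.neg.mul hvr).sub (hpr.mul (hv.hasDerivAt_p r hr)))).sub
      (((((hasDerivAt_pow_div n hr).const_mul ((n : ℝ) + 1)).mul hpr).mul hvr))
    refine h1.congr_deriv ?_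
    simp only [Function.comp, Pi.neg_apply, Pi.mul_apply, Pi.sub_apply]
    push_cast
    field_simp
    ring
  have hcont : ContinuousOn W (Ici 0) := by
    have hp := g.sol.cont_p
    have hv' := hv.cont_u
    have hq := hv.cont_p
    have hFu := hF.continuous_F.comp_continuousOn g.sol.cont_u
    exact ((Continuous.continuousOn (by fun_prop)).mul ((hFu.neg.mul hv').sub (hp.mul hq))).sub
      (((Continuous.continuousOn (by fun_prop)).mul hp).mul hv')
  have hanti : StrictAntiOn W (Ici 0) := by
    refine strictAntiOn_of_deriv_neg (convex_Ici 0) hcont fun r hr => ?_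
    rw [interior_Ici] at hr
    have hr0 : 0 < r := hr
    rw [(hd r hr).deriv]
    have h1 := g.deriv_neg r hr
    have h2 := hvpos r hr0.le
    have h3 : 0 < (n + 1) / r ^ 2 * r ^ (n + 1) * v r := by positivity
    nlinarith
  have hW0 : W 0 = 0 := by simp [hWdef, g.sol.p_zero]
  have hW1 : W 1 < 0 := by
    rw [← hW0]; exact hanti self_mem_Ici (by simp) one_pos
  have hpos : ∀ᶠ r : ℝ in atTop, 0 < r := eventually_gt_atTop 0
  have hneg := eventually_neg_of_wronskian (n := n + 1) (f := p)
    (f' := fun r => -(((n + 1 : ℕ) : ℝ) / r * p r) - F (u r)) (v := v) (q := q) (δ := -W 1)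
    (by linarith)
    (hpos.mono g.deriv_neg) (hpos.mono g.sol.hasDerivAt_p) (hpos.mono hv.hasDerivAt_u) ?_
    g.tendsto_p (g.tendsto_pow_mul_p hF (n + 1))
  · obtain ⟨r, h1, h2⟩ := (hneg.and hpos).exists
    linarith [hvpos r h2.le]
  · filter_upwards [eventually_ge_atTop 1] with r hr
    have h1 := hanti.antitoneOn (by simp) (show r ∈ Ici (0 : ℝ) by simp; linarith) hr
    have h2 : W r = r ^ (n + 1) *
        ((-(((n + 1 : ℕ) : ℝ) / r * p r) - F (u r)) * v r - p r * q r) := by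
      have : r ≠ 0 := by positivity
      simp only [hWdef]
      push_cast
      field_simp
      ring
    rw [← h2]
    linarith

/-! ### The Pohozaev identity and the monotonicity of `-r u' / u` -/

lemma pohozaev_sign (hF : GroundStateNonlinearity F F' Φ B L M) {x x' : ℝ} (hx : 0 < x)
    (hxx' : x < x') (hx' : x' < B) (h : 0 ≤ 2 * (n + 2) * Φ x - n * (x * F x)) :
    0 < 2 * (n + 2) * Φ x' - n * (x' * F x') := by
  have hd : ∀ t, HasDerivAt (fun t => 2 * (n + 2) * Φ t - n * (t * F t))
      ((n + 4) * F t - n * (t * F' t)) t := by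
    intro t
    refine (((hF.hasDerivAt_Φ t).const_mul (2 * ((n : ℝ) + 2))).sub
      (((hasDerivAt_id t).mul (hF.hasDerivAt_F t)).const_mul (n : ℝ))).congr_deriv ?_
    simp only [id]
    ring
  have hcont : Continuous fun t => 2 * (n + 2) * Φ t - n * (t * F t) :=
    continuous_iff_continuousAt.2 fun t => (hd t).continuousAt
  obtain ⟨ξ, hξ, hξe⟩ := exists_hasDerivAt_eq_slope _ _ hx hcont.continuousOn fun t _ => hd t
  have hξ0 : 0 ≤ (n + 4) * F ξ - n * (ξ * F' ξ) := by
    rw [hξe, hF.Φ_zero]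
    simp only [mul_zero, zero_mul, sub_zero]
    positivity
  have hpos : ∀ t, ξ < t → t < B → 0 < (n + 4) * F t - n * (t * F' t) := by
    intro t h1 h2
    rcases Nat.eq_zero_or_pos n with rfl | hn
    · have := hF.F_pos_of_lt ξ t hξ.1 h1 h2 (by push_cast at hξ0; linarith)
      push_cast
      linarith
    · have hn' : (0 : ℝ) < n := by exact_mod_cast hn
      have := hF.sign_change ((n + 4) / n) ξ t (by rw [le_div_iff₀ hn']; linarith) hξ.1 h1 h2
        (by rw [div_mul_eq_mul_div, le_div_iff₀ hn']; linarith)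
      rw [div_mul_eq_mul_div, lt_div_iff₀ hn'] at this
      linarith
  have hmono : StrictMonoOn (fun t => 2 * (n + 2) * Φ t - n * (t * F t)) (Icc ξ x') := by
    refine strictMonoOn_of_deriv_pos (convex_Icc ξ x') hcont.continuousOn fun t ht => ?_
    rw [interior_Icc] at ht
    rw [(hd t).deriv]
    exact hpos t ht.1 (ht.2.trans hx')
  exact h.trans_lt (hmono ⟨hξ.2.le, hxx'.le⟩ ⟨(hξ.2.trans hxx').le, le_rfl⟩ hxx')

/-- The Pohozaev functional of a ground state is positive: it vanishes at both ends of
`[0, ∞)` and first increases, then decreases. -/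
lemma pohozaev_pos (hF : GroundStateNonlinearity F F' Φ B L M)
    (g : GroundState (n + 1) F B u p) {r : ℝ} (hr : 0 < r) :
    0 < r ^ (n + 2) * (p r ^ 2 + 2 * Φ (u r)) + n * r ^ (n + 1) * u r * p r := by
  set P : ℝ → ℝ := fun r => r ^ (n + 2) * (p r ^ 2 + 2 * Φ (u r)) + n * r ^ (n + 1) * u r * p r
    with hP
  have hd : ∀ r, 0 < r → HasDerivAt P
      (r ^ (n + 1) * (2 * (n + 2) * Φ (u r) - n * (u r * F (u r)))) r := by
    intro r hr
    have hur := g.sol.hasDerivAt_u r hr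
    have hpr := g.sol.hasDerivAt_p r hr
    have hΦ := (hF.hasDerivAt_Φ (u r)).comp r hur
    have h1 := ((hasDerivAt_pow_div (n + 2) hr).mul ((hpr.pow 2).add (hΦ.const_mul 2))).add
      ((((hasDerivAt_pow_div (n + 1) hr).const_mul (n : ℝ)).mul hur).mul hpr)
    refine h1.congr_deriv ?_
    simp only [Function.comp, Pi.add_apply, Pi.mul_apply, Pi.pow_apply]
    push_cast
    field_simp
    ring
  have hcont : ContinuousOn P (Ici 0) := by
    have hp := g.sol.cont_p
    have hu := g.sol.cont_u
    have hΦ := hF.continuous_Φ.comp_continuousOn hu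
    exact ((Continuous.continuousOn (by fun_prop)).mul ((hp.pow 2).add
      (continuousOn_const.mul hΦ))).add
      (((Continuous.continuousOn (by fun_prop)).mul hu).mul hp)
  have hP0 : P 0 = 0 := by simp [hP]
  have hur := g.pos r hr.le
  change 0 < P r
  rcases le_or_gt 0 (2 * (n + 2) * Φ (u r) - n * (u r * F (u r))) with hK | hK
  · have hmono : StrictMonoOn P (Icc 0 r) := by
      refine strictMonoOn_of_deriv_pos (convex_Icc 0 r) (hcont.mono fun x hx => hx.1)
        fun t ht => ?_
      rw [interior_Icc] at ht
      rw [(hd t ht.1).deriv]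
      have h0 := ht.1
      have := pohozaev_sign hF hur (g.strictAntiOn ht.1.le hr.le ht.2) (g.lt_B ht.1.le) hK
      positivity
    rw [← hP0]
    exact hmono ⟨le_rfl, hr.le⟩ ⟨hr.le, le_rfl⟩ hr
  · have hanti : StrictAntiOn P (Ici r) := by
      refine strictAntiOn_of_deriv_neg (convex_Ici r)
        (hcont.mono fun x hx => hr.le.trans hx) fun t ht => ?_
      rw [interior_Ici] at ht
      have ht' : r < t := ht
      have h0 : 0 < t := hr.trans ht
      rw [(hd t h0).deriv]
      refine mul_neg_of_pos_of_neg (by positivity) ?_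
      by_contra! hcon
      have := pohozaev_sign hF (g.pos t h0.le) (g.strictAntiOn hr.le h0.le ht') (g.lt_B hr.le) hcon
      linarith
    have hΦ0 : Tendsto (fun r => r ^ (n + 2) * Φ (u r)) atTop (𝓝 0) := by
      refine squeeze_zero_norm' (a := fun r => L * (r ^ (n + 2) * u r) * u r) ?_
        (by simpa using ((g.tendsto_pow_mul_u hF (n + 2)).const_mul L).mul g.tendsto_u)
      filter_upwards [eventually_ge_atTop 0] with r hr
      rw [norm_mul, norm_pow, Real.norm_eq_abs, Real.norm_eq_abs, abs_of_nonneg hr]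
      calc r ^ (n + 2) * |Φ (u r)| ≤ r ^ (n + 2) * (L * u r * u r) := by
            gcongr
            exact hF.abs_Φ_le (g.pos r hr).le
        _ = _ := by ring
    have hlim : Tendsto P atTop (𝓝 0) := by
      have h1 := (((g.tendsto_pow_mul_p hF (n + 2)).mul g.tendsto_p).add
        (hΦ0.const_mul 2)).add
        (((g.tendsto_pow_mul_p hF (n + 1)).mul g.tendsto_u).const_mul (n : ℝ))
      simp only [mul_zero, add_zero] at h1
      refine h1.congr fun r => ?_
      simp only [hP]
      ring
    have h1 : 0 ≤ P (r + 1) := by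
      refine le_of_tendsto hlim ?_
      filter_upwards [eventually_ge_atTop (r + 1)] with s hs
      exact hanti.antitoneOn (show r ≤ r + 1 by linarith) (show r ≤ s by linarith) hs
    have h2 : P (r + 1) < P r := hanti self_mem_Ici (show r ≤ r + 1 by linarith) (by linarith)
    linarith

/-- `-r u' / u` increases wherever `u F(u) > 2 Φ(u)`; hence `r u' + c u`, once zero, is
negative. -/
lemma mul_deriv_add_neg (hF : GroundStateNonlinearity F F' Φ B L M)
    (g : GroundState (n + 1) F B u p) {c r1 : ℝ} (hr1 : 0 < r1)
    (hG : ∀ r, r1 ≤ r → 0 < u r * F (u r) - 2 * Φ (u r)) (hc : r1 * p r1 + c * u r1 = 0)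
    {r : ℝ} (hr : r1 < r) : r * p r + c * u r < 0 := by
  have hd : ∀ t, r1 ≤ t → HasDerivAt (fun t => t * p t / u t)
      (((1 * p t + t * (-(((n + 1 : ℕ) : ℝ) / t * p t) - F (u t))) * u t - t * p t * p t)
        / u t ^ 2) t := by
    intro t ht
    have ht0 : 0 < t := hr1.trans_le ht
    exact ((hasDerivAt_id t).mul (g.sol.hasDerivAt_p t ht0)).div (g.sol.hasDerivAt_u t ht0)
      (g.pos t ht0.le).ne'
  have hanti : StrictAntiOn (fun t => t * p t / u t) (Ici r1) := by
    refine strictAntiOn_of_deriv_neg (convex_Ici r1)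
      (fun t ht => (hd t ht).continuousAt.continuousWithinAt) fun t ht => ?_
    rw [interior_Ici] at ht
    have ht' : r1 ≤ t := le_of_lt ht
    have ht0 : 0 < t := hr1.trans ht
    rw [(hd t ht').deriv]
    have hu := g.pos t ht0.le
    refine div_neg_of_neg_of_pos ?_ (by positivity)
    have h1 := pohozaev_pos hF g ht0
    have h2 : 0 < t ^ (n + 2) * (u t * F (u t) - 2 * Φ (u t)) := by
      have := hG t ht'
      positivity
    have h3 : t ^ (n + 1) * ((1 * p t + t * (-(((n + 1 : ℕ) : ℝ) / t * p t) - F (u t))) * u t -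
        t * p t * p t) = -((t ^ (n + 2) * (p t ^ 2 + 2 * Φ (u t)) + n * t ^ (n + 1) * u t * p t) +
          t ^ (n + 2) * (u t * F (u t) - 2 * Φ (u t))) := by
      push_cast
      field_simp
      ring
    by_contra! hcon
    have : 0 ≤ t ^ (n + 1) * ((1 * p t + t * (-(((n + 1 : ℕ) : ℝ) / t * p t) - F (u t))) * u t -
        t * p t * p t) := mul_nonneg (by positivity) hcon
    linarith
  have h1 := hanti self_mem_Ici hr.le hr
  simp only at h1
  have hu := g.pos r (hr1.trans hr).le
  have hu1 := g.pos r1 hr1.le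
  rw [div_lt_div_iff₀ hu hu1] at h1
  have h2 : r1 * p r1 * u r = -(c * u r) * u r1 := by linear_combination u r * hc
  nlinarith

/-! ### Divergence of the linearized solution in dimension at least two -/

/-- `u F(u) > 2 Φ(u)` from the first zero of `v` on. Comparison of `v` with `u` shows that
`u F'(u) > F(u)` somewhere before this zero, hence everywhere after. -/
lemma mul_F_sub_pos (hF : GroundStateNonlinearity F F' Φ B L M)
    (g : GroundState (n + 1) F B u p)
    (hv : RadialSolution (n + 1) (fun r x => F' (u r) * x) v q) {r1 : ℝ} (hr1 : 0 < r1)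
    (hvpos : ∀ r, 0 ≤ r → r < r1 → 0 < v r) (hvr1 : v r1 = 0) (hq : q r1 < 0) {r : ℝ}
    (hr : r1 ≤ r) : 0 < u r * F (u r) - 2 * Φ (u r) := by
  have hd : ∀ r, 0 < r → HasDerivAt (fun r => r ^ (n + 1) * (p r * v r - u r * q r))
      (r ^ (n + 1) * v r * (u r * F' (u r) - F (u r))) r := by
    intro r hr
    have h1 := (hasDerivAt_pow_div (n + 1) hr).mul (((g.sol.hasDerivAt_p r hr).mul
      (hv.hasDerivAt_u r hr)).sub ((g.sol.hasDerivAt_u r hr).mul (hv.hasDerivAt_p r hr)))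
    refine h1.congr_deriv ?_
    simp only [Pi.mul_apply, Pi.sub_apply]
    push_cast
    field_simp
    ring
  have hcont : ContinuousOn (fun r => r ^ (n + 1) * (p r * v r - u r * q r)) (Icc 0 r1) := by
    refine ContinuousOn.mono ?_ (fun x hx => hx.1 : Icc 0 r1 ⊆ Ici 0)
    exact (Continuous.continuousOn (by fun_prop)).mul ((g.sol.cont_p.mul hv.cont_u).sub
      (g.sol.cont_u.mul hv.cont_p))
  obtain ⟨ξ, hξ, hξe⟩ := exists_hasDerivAt_eq_slope _ _ hr1 hcont fun t ht => hd t ht.1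
  have hu1 := g.pos r1 hr1.le
  have hξpos : 0 < u ξ * F' (u ξ) - F (u ξ) := by
    have h1 : 0 < ξ ^ (n + 1) * v ξ * (u ξ * F' (u ξ) - F (u ξ)) := by
      rw [hξe, hvr1, g.sol.p_zero, hv.p_zero]
      have : 0 < -q r1 := by linarith
      have h2 : 0 < r1 ^ (n + 1) * (u r1 * -q r1) := by positivity
      simp only [mul_zero, zero_mul, sub_zero]
      refine div_pos ?_ hr1
      linarith
    have h2 := hvpos ξ hξ.1.le hξ.2
    have h3 := hξ.1
    exact pos_of_mul_pos_right h1 (by positivity)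
  have hpos : ∀ x, 0 < x → x < u ξ → 0 < x * F' x - F x := by
    intro x hx hxξ
    by_contra! hcon
    have := hF.sign_change 1 x (u ξ) le_rfl hx hxξ (g.lt_B hξ.1.le) (by linarith)
    linarith
  have hmono : StrictMonoOn (fun x => x * F x - 2 * Φ x) (Icc 0 (u ξ)) := by
    have hd : ∀ x, HasDerivAt (fun x => x * F x - 2 * Φ x) (x * F' x - F x) x := by
      intro x
      refine (((hasDerivAt_id x).mul (hF.hasDerivAt_F x)).sub
        ((hF.hasDerivAt_Φ x).const_mul 2)).congr_deriv ?_
      simp only [id]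
      ring
    refine strictMonoOn_of_deriv_pos (convex_Icc _ _)
      (fun x _ => (hd x).continuousAt.continuousWithinAt) fun x hx => ?_
    rw [interior_Icc] at hx
    rw [(hd x).deriv]
    exact hpos x hx.1 hx.2
  have hr0 : 0 < r := hr1.trans_le hr
  have hur := g.pos r hr0.le
  have h1 := hmono ⟨le_rfl, (g.pos ξ hξ.1.le).le⟩
    ⟨hur.le, (g.strictAntiOn hξ.1.le hr0.le (hξ.2.trans_le hr)).le⟩ hur
  simpa [hF.Φ_zero] using h1

/-- In dimension at least two the linearized solution tends to `-∞`. It is compared with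
`f = r u' + c u`, where `c` is such that `f` and `v` vanish at the same first point `r1`. By
Rolle's theorem the forcing term `u F'(u) - (1 + 2/c) F(u)` of the Wronskian vanishes before `r1`,
hence is positive after `r1`. -/
lemma linearized_exponential_of_succ (hF : GroundStateNonlinearity F F' Φ B L M)
    (g : GroundState (n + 1) F B u p)
    (hv : RadialSolution (n + 1) (fun r x => F' (u r) * x) v q) (hv0 : v 0 = 1) :
    TendsToNegInftyExponentially v ∧ TendsToNegInftyExponentially q := by
  obtain ⟨r0, hr0, hvr0⟩ := exists_linearized_nonpos hF g hv
  obtain ⟨r1, hr1, -, hvr1, hvpos⟩ := exists_first_zero hr0 (hv.cont_u.mono fun x hx => hx.1)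
    (by rw [hv0]; exact one_pos) hvr0
  have hq1 : q r1 < 0 := by
    refine (deriv_nonpos_of_left (hv.hasDerivAt_u r1 hr1) hvr1 hr1
      fun t h1 h2 => (hvpos t h1.le h2).le).lt_of_ne ?_
    refine hv.deriv_ne_zero_of_eq_zero hF.L_nonneg (fun r _ x => ?_) (by rw [hv0]; exact one_ne_zero)
      hr1 hvr1
    rw [abs_mul]
    exact mul_le_mul_of_nonneg_right (hF.abs_F'_le _) (abs_nonneg _)
  have hu1 := g.pos r1 hr1.le
  have hp1 := g.deriv_neg r1 hr1
  set c : ℝ := -(r1 * p r1) / u r1 with hc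
  have hc0 : 0 < c := by
    refine div_pos ?_ hu1
    nlinarith
  have hfr1 : r1 * p r1 + c * u r1 = 0 := by
    rw [hc]; field_simp; ring
  have hfneg : ∀ r, r1 < r → r * p r + c * u r < 0 := fun r hr =>
    mul_deriv_add_neg hF g hr1 (fun r hr => mul_F_sub_pos hF g hv hr1 hvpos hvr1 hq1 hr) hfr1 hr
  set f : ℝ → ℝ := fun r => r * p r + c * u r with hf
  set f' : ℝ → ℝ := fun r => (c - n) * p r - r * F (u r) with hf'
  have hfd : ∀ r, 0 < r → HasDerivAt f (f' r) r := by
    intro r hr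
    refine (((hasDerivAt_id r).mul (g.sol.hasDerivAt_p r hr)).add
      ((g.sol.hasDerivAt_u r hr).const_mul c)).congr_deriv ?_
    simp only [hf', id]
    push_cast
    field_simp
    ring
  set W : ℝ → ℝ := fun r => r ^ (n + 1) * (f' r * v r - f r * q r) with hW
  have hWd : ∀ r, 0 < r → HasDerivAt W
      (r ^ (n + 1) * v r * (c * (u r * F' (u r)) - (2 + c) * F (u r))) r := by
    intro r hr
    have hFu := (hF.hasDerivAt_F (u r)).comp r (g.sol.hasDerivAt_u r hr)
    have hf'd := ((g.sol.hasDerivAt_p r hr).const_mul (c - n)).sub ((hasDerivAt_id r).mul hFu)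
    have h1 := (hasDerivAt_pow_div (n + 1) hr).mul ((hf'd.mul (hv.hasDerivAt_u r hr)).sub
      ((hfd r hr).mul (hv.hasDerivAt_p r hr)))
    refine h1.congr_deriv ?_
    simp only [hf, hf', id, Function.comp, Pi.mul_apply, Pi.sub_apply]
    push_cast
    field_simp
    ring
  have hWc : ContinuousOn W (Ici 0) := by
    have hFu := hF.continuous_F.comp_continuousOn g.sol.cont_u
    have hf1 : ContinuousOn f (Ici 0) :=
      (continuousOn_id.mul g.sol.cont_p).add (continuousOn_const.mul g.sol.cont_u)
    have hf2 : ContinuousOn f' (Ici 0) :=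
      (continuousOn_const.mul g.sol.cont_p).sub (continuousOn_id.mul hFu)
    exact (Continuous.continuousOn (by fun_prop)).mul ((hf2.mul hv.cont_u).sub (hf1.mul hv.cont_p))
  have hWr1 : W r1 = 0 := by
    simp only [hW, hf, hfr1, hvr1]; ring
  have hW0 : W 0 = 0 := by
    simp [hW]
  obtain ⟨ξ, hξ, hξe⟩ := exists_hasDerivAt_eq_zero hr1 (hWc.mono fun x hx => hx.1)
    (hW0.trans hWr1.symm) fun t ht => hWd t ht.1
  have hξ0 : 0 < ξ := hξ.1
  have hIξ : c * (u ξ * F' (u ξ)) = (2 + c) * F (u ξ) := by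
    have h1 := hvpos ξ hξ.1.le hξ.2
    have h2 : ξ ^ (n + 1) * v ξ ≠ 0 := by positivity
    linarith [(mul_eq_zero.1 hξe).resolve_left h2]
  have hIpos : ∀ r, r1 ≤ r → 0 < c * (u r * F' (u r)) - (2 + c) * F (u r) := by
    intro r hr
    by_contra! hcon
    have hr' : 0 ≤ r := hr1.le.trans hr
    have := hF.sign_change ((2 + c) / c) (u r) (u ξ) (by rw [le_div_iff₀ hc0]; linarith)
      (g.pos r hr') (g.strictAntiOn hξ0.le hr' (hξ.2.trans_le hr)) (g.lt_B hξ0.le)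
      (by rw [div_mul_eq_mul_div, le_div_iff₀ hc0]; linarith)
    rw [div_mul_eq_mul_div, lt_div_iff₀ hc0] at this
    linarith
  have hanti : ∀ s, (∀ t, r1 < t → t < s → v t < 0) → StrictAntiOn W (Icc r1 s) := by
    intro s hs
    refine strictAntiOn_of_deriv_neg (convex_Icc _ _)
      (hWc.mono fun x hx => hr1.le.trans hx.1) fun t ht => ?_
    rw [interior_Icc] at ht
    have ht0 : 0 < t := hr1.trans ht.1
    rw [(hWd t ht0).deriv]
    have h1 := hs t ht.1 ht.2
    have h2 := hIpos t ht.1.le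
    have h3 : 0 < t ^ (n + 1) := by positivity
    exact mul_neg_of_neg_of_pos (mul_neg_of_pos_of_neg h3 h1) h2
  have hvneg : ∀ r, r1 < r → v r < 0 := by
    intro r hr
    by_contra! hcon
    obtain ⟨a, har1, har, hva⟩ : ∃ a, r1 < a ∧ a < r ∧ ∀ t, r1 < t → t ≤ a → v t < 0 := by
      have h1 : ∀ᶠ t in 𝓝[>] r1, slope v r1 t < 0 :=
        ((hasDerivAt_iff_tendsto_slope.1 (hv.hasDerivAt_u r1 hr1)).mono_left
          (nhdsWithin_mono _ fun t ht => ne_of_gt ht)).eventually_lt_const hq1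
      obtain ⟨a, ha, h2⟩ := mem_nhdsGT_iff_exists_Ioc_subset.1 h1
      have hneg : ∀ t, r1 < t → t ≤ a → v t < 0 := by
        intro t h3 h4
        have h5 : slope v r1 t < 0 := h2 ⟨h3, h4⟩
        rw [slope_def_field, hvr1, sub_zero] at h5
        exact (div_neg_iff.1 h5).resolve_left (fun h => by linarith [h.2]) |>.1
      refine ⟨min a ((r1 + r) / 2), lt_min ha (by linarith),
        (min_le_right _ _).trans_lt (by linarith), fun t h3 h4 => hneg t h3 (h4.trans (min_le_left _ _))⟩
    obtain ⟨r2, h1, h2, h3, h4⟩ := exists_first_zero (f := fun t => -v t) har.le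
      (hv.cont_u.neg.mono fun x hx => (hr1.trans har1).le.trans hx.1)
      (by linarith [hva a har1 le_rfl]) (by linarith)
    have hr2 : r1 < r2 := har1.trans h1
    have hneg : ∀ t, r1 < t → t < r2 → v t < 0 := by
      intro t h5 h6
      rcases le_or_gt t a with h7 | h7
      · exact hva t h5 h7
      · linarith [h4 t h7.le h6]
    have hq2 : 0 ≤ q r2 := by
      have := deriv_nonpos_of_left (hv.hasDerivAt_u r2 (hr1.trans hr2)).neg h3 hr2
        fun t h5 h6 => by simpa using (hneg t h5 h6).le
      linarith
    have hW2 := hanti r2 hneg ⟨le_rfl, hr2.le⟩ ⟨hr2.le, le_rfl⟩ hr2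
    rw [hWr1] at hW2
    have hv2 : v r2 = 0 := by linarith
    simp only [hW, hv2] at hW2
    have hf2 : f r2 < 0 := hfneg r2 hr2
    have h5 : 0 < r2 ^ (n + 1) := pow_pos (hr1.trans hr2) _
    have h6 : 0 ≤ r2 ^ (n + 1) * (-f r2 * q r2) := by
      have : 0 < -f r2 := by linarith
      positivity
    linarith
  have hWle : ∀ r, r1 + 1 ≤ r → W r ≤ W (r1 + 1) := fun r hr =>
    (hanti r fun t h1 _ => hvneg t h1).antitoneOn ⟨by linarith, hr⟩ ⟨by linarith, le_rfl⟩ hr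
  have hW1 : W (r1 + 1) < 0 := by
    rw [← hWr1]
    exact hanti (r1 + 1) (fun t h1 _ => hvneg t h1) ⟨le_rfl, by linarith⟩ ⟨by linarith, le_rfl⟩
      (by linarith)
  have hpos : ∀ᶠ r : ℝ in atTop, 0 < r := eventually_gt_atTop 0
  have hpw : ∀ k, Tendsto (fun r => r ^ k * f r) atTop (𝓝 0) := by
    intro k
    have h1 := (g.tendsto_pow_mul_p hF (k + 1)).add ((g.tendsto_pow_mul_u hF k).const_mul c)
    rw [mul_zero, add_zero] at h1
    refine h1.congr fun r => ?_
    simp only [hf]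
    ring
  refine exponential_of_wronskian hF g hv (f := f) (f' := f') (δ := -W (r1 + 1)) (by linarith)
    ?_ (hpos.mono hfd) ?_ (by simpa using hpw 0) (hpw _) ?_
  · filter_upwards [eventually_gt_atTop r1] with r hr using hfneg r hr
  · filter_upwards [eventually_ge_atTop (r1 + 1)] with r hr
    rw [neg_neg]
    exact hWle r hr
  · have h1 := ((g.tendsto_pow_mul_p hF (n + 1)).const_mul (c - n)).sub
      (g.tendsto_pow_mul_F hF (n + 2))
    rw [mul_zero, sub_zero] at h1
    refine h1.congr fun r => ?_
    simp only [hf']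
    ring

lemma linearized_exponential (hF : GroundStateNonlinearity F F' Φ B L M)
    (g : GroundState n F B u p) (hv : RadialSolution n (fun r x => F' (u r) * x) v q)
    (hv0 : v 0 = 1) :
    TendsToNegInftyExponentially v ∧ TendsToNegInftyExponentially q := by
  cases n with
  | zero => exact linearized_exponential_of_zero hF g hv hv0
  | succ n => exact linearized_exponential_of_succ hF g hv hv0

end Linearized

/-! ### Shooting -/

section Shooting

variable {F F' Φ : ℝ → ℝ} {B L M : ℝ} {n : ℕ} {U P : ℝ → ℝ → ℝ}

lemma exists_shooting (hF : GroundStateNonlinearity F F' Φ B L M) (n : ℕ) :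
    ∃ U P : ℝ → ℝ → ℝ, ∀ y, RadialSolution n (fun _ x => F x) (U y) (P y) ∧ U y 0 = y := by
  have h := fun y => exists_radialSolution n (G := fun _ x => F x) (C := 0) hF.L_nonneg
    (hF.continuous_F.comp continuous_snd) (fun _ => hF.abs_F_sub_le) (by simp [hF.F_zero]) y
  choose U P hUP using h
  exact ⟨U, P, hUP⟩

lemma exists_linearized (hF : GroundStateNonlinearity F F' Φ B L M) {u p : ℝ → ℝ}
    (h : RadialSolution n (fun _ x => F x) u p) :
    ∃ v q, RadialSolution n (fun r x => F' (u r) * x) v q ∧ v 0 = 1 := by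
  have hu : Continuous fun r => u (max r 0) :=
    h.cont_u.comp_continuous (by fun_prop) fun r => mem_Ici.2 (le_max_right r 0)
  obtain ⟨v, q, hv, hv0⟩ := exists_radialSolution n (G := fun r x => F' (u (max r 0)) * x)
    (L := L) (C := 0) hF.L_nonneg
    ((hF.continuous_F'.comp (hu.comp continuous_fst)).mul continuous_snd)
    (fun r x y => by
      rw [← mul_sub, abs_mul]
      exact mul_le_mul_of_nonneg_right (hF.abs_F'_le _) (abs_nonneg _)) (by simp) 1
  refine ⟨v, q, ⟨hv.cont_u, hv.cont_p, hv.p_zero, hv.hasDerivAt_u, fun r hr => ?_⟩, hv0⟩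
  have := hv.hasDerivAt_p r hr
  rwa [max_eq_left hr.le] at this

/-- The linearized solution is the derivative of the solution with respect to its initial value,
with an error that is quadratic in the increment of the initial value. -/
lemma abs_sub_linearized_le (hF : GroundStateNonlinearity F F' Φ B L M) {u p v q : ℝ → ℝ}
    (h : RadialSolution n (fun _ x => F x) u p)
    (hv : RadialSolution n (fun r x => F' (u r) * x) v q) (hv0 : v 0 = 1) {R : ℝ} (hR : 0 ≤ R) :
    ∃ D, 0 ≤ D ∧ ∀ {u' p' : ℝ → ℝ}, RadialSolution n (fun _ x => F x) u' p' →
      |u' R - u R - (u' 0 - u 0) * v R| ≤ D * (u' 0 - u 0) ^ 2 ∧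
        |p' R - p R - (u' 0 - u 0) * q R| ≤ D * (u' 0 - u 0) ^ 2 := by
  have hL := hF.L_nonneg
  have hM := hF.M_nonneg
  set K := 1 + L * Real.exp ((2 + L) * R) with hK
  have hK0 : 0 < K := by positivity
  refine ⟨M * K ^ 2 * Real.exp ((2 + L) * R), by positivity, fun {u' p'} h' => ?_⟩
  set y := u' 0 - u 0 with hy
  have hg := gronwall_radial (n := n) (z := fun r => u' r - u r - y * v r)
    (q := fun r => p' r - p r - y * q r)
    (s := fun r => F (u' r) - F (u r) - y * (F' (u r) * v r)) (A := L) (D := M * (K * |y|) ^ 2)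
    (R := R) hL ((h'.cont_u.sub h.cont_u).sub (continuousOn_const.mul hv.cont_u))
    ((h'.cont_p.sub h.cont_p).sub (continuousOn_const.mul hv.cont_p)) (by simp [hy, hv0])
    (by simp [h.p_zero, h'.p_zero, hv.p_zero])
    (fun r hr => ((h'.hasDerivAt_u r hr).sub (h.hasDerivAt_u r hr)).sub
      ((hv.hasDerivAt_u r hr).const_mul y))
    (fun r hr => (((h'.hasDerivAt_p r hr).sub (h.hasDerivAt_p r hr)).sub
      ((hv.hasDerivAt_p r hr).const_mul y)).congr_deriv (by ring))
    (fun r hr hrR => by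
      have e : F (u' r) - F (u r) - y * (F' (u r) * v r) = F' (u r) * (u' r - u r - y * v r) +
          (F (u' r) - F (u r) - F' (u r) * (u' r - u r)) := by ring
      rw [e]
      refine (abs_add_le _ _).trans (add_le_add ?_ ?_)
      · rw [abs_mul]
        exact mul_le_mul_of_nonneg_right (hF.abs_F'_le _) (abs_nonneg _)
      · refine (hF.abs_taylor_le _ _).trans (mul_le_mul_of_nonneg_left ?_ hM)
        have h1 := (h'.abs_sub_le hL (fun _ _ => hF.abs_F_sub_le) h hr.le).1
        have h2 : (1 + L * Real.exp ((2 + L) * r)) * |u' 0 - u 0| ≤ K * |y| := by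
          rw [hK, hy]
          gcongr
        exact pow_le_pow_left₀ (abs_nonneg _) (h1.trans h2) 2) hR le_rfl
  have h1 : 1 ≤ Real.exp ((2 + L) * R) := Real.one_le_exp (by positivity)
  set D := M * K ^ 2 * Real.exp ((2 + L) * R) * y ^ 2 with hD
  have hD0 : 0 ≤ D := by positivity
  have hexp : (M * (K * |y|) ^ 2) ^ 2 * Real.exp ((2 + L) * R) ≤ D ^ 2 := by
    have e : D ^ 2 = (M * (K * |y|) ^ 2) ^ 2 * Real.exp ((2 + L) * R) ^ 2 := by
      rw [hD, mul_pow K, sq_abs]; ring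
    rw [e]
    refine mul_le_mul_of_nonneg_left ?_ (sq_nonneg _)
    nlinarith
  constructor
  · exact abs_le_of_sq_le_sq (by nlinarith [sq_nonneg (p' R - p R - y * q R)]) hD0
  · exact abs_le_of_sq_le_sq (by nlinarith [sq_nonneg (u' R - u R - y * v R)]) hD0

/-- As long as two solutions stay where `F` is decreasing, an ordering of the solutions and of
their derivatives persists, and their distance grows. -/
lemma sub_ge_of_le (hF : GroundStateNonlinearity F F' Φ B L M) {u p u' p' : ℝ → ℝ}
    (h : RadialSolution n (fun _ x => F x) u p) (h' : RadialSolution n (fun _ x => F x) u' p')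
    {δ m R T : ℝ} (hm : 0 < m) (hF' : ∀ x, |x| ≤ δ → F' x ≤ -m) (hR : 0 < R)
    (hu : u R < u' R) (hp : p R < p' R) (hlow : ∀ r, R ≤ r → r ≤ T → -δ ≤ u r)
    (hup : ∀ r, R ≤ r → r ≤ T → u' r ≤ δ) (hRT : R ≤ T) : u' R - u R ≤ u' T - u T := by
  have hmono : ∀ c, (∀ t, R ≤ t → t < c → 0 < p' t - p t) →
      StrictMonoOn (fun r => u' r - u r) (Icc R c) := by
    intro c hc
    have hd : ∀ t, R ≤ t → HasDerivAt (fun r => u' r - u r) (p' t - p t) t := fun t ht =>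
      (h'.hasDerivAt_u t (hR.trans_le ht)).sub (h.hasDerivAt_u t (hR.trans_le ht))
    refine strictMonoOn_of_deriv_pos (convex_Icc _ _)
      (fun t ht => (hd t ht.1).continuousAt.continuousWithinAt) fun t ht => ?_
    rw [interior_Icc] at ht
    rw [(hd t ht.1.le).deriv]
    exact hc t ht.1.le ht.2
  have hpos : ∀ t, R ≤ t → t ≤ T → 0 < p' t - p t := by
    intro t h1 h2
    by_contra! hcon
    have hcont : ContinuousOn (fun r => p' r - p r) (Icc R t) :=
      (h'.cont_p.sub h.cont_p).mono fun x hx => hR.le.trans hx.1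
    obtain ⟨c, hc1, hc2, hc3, hc4⟩ := exists_first_zero h1 hcont (by linarith) hcon
    have hw := hmono c hc4
    have hd : ∀ s, R ≤ s → HasDerivAt (fun r => r ^ n * (p' r - p r))
        (-(s ^ n * (F (u' s) - F (u s)))) s := by
      intro s hs
      have hs0 := hR.trans_le hs
      refine ((hasDerivAt_pow_div n hs0).mul
        ((h'.hasDerivAt_p s hs0).sub (h.hasDerivAt_p s hs0))).congr_deriv ?_
      simp only [Pi.sub_apply]
      ring
    have hmono2 : StrictMonoOn (fun r => r ^ n * (p' r - p r)) (Icc R c) := by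
      refine strictMonoOn_of_deriv_pos (convex_Icc _ _)
        (fun t ht => (hd t ht.1).continuousAt.continuousWithinAt) fun s hs => ?_
      rw [interior_Icc] at hs
      rw [(hd s hs.1.le).deriv]
      have h3 := hw ⟨le_rfl, hc1.le⟩ ⟨hs.1.le, hs.2.le⟩ hs.1
      simp only at h3
      have hsT : s ≤ T := hs.2.le.trans (hc2.trans h2)
      have h4 := hF.F_le_of_F'_le hF' (hlow s hs.1.le hsT) (by linarith) (hup s hs.1.le hsT)
      have h5 : 0 < s ^ n := pow_pos (hR.trans hs.1) n
      have h6 : F (u' s) - F (u s) < 0 := by nlinarith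
      nlinarith
    have h7 := hmono2 ⟨le_rfl, hc1.le⟩ ⟨hc1.le, le_rfl⟩ hc1
    simp only [hc3, mul_zero] at h7
    have h8 : 0 < R ^ n * (p' R - p R) := mul_pos (pow_pos hR n) (by linarith)
    linarith
  exact (hmono T fun t h1 h2 => hpos t h1 h2.le).monotoneOn ⟨le_rfl, hRT⟩ ⟨hRT, le_rfl⟩ hRT

/-- A solution of negative energy cannot vanish. -/
lemma pos_of_energy_neg (hF : GroundStateNonlinearity F F' Φ B L M) {u p : ℝ → ℝ}
    (h : RadialSolution n (fun _ x => F x) u p) {r0 : ℝ} (hr0 : 0 ≤ r0)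
    (hpos : ∀ r, 0 ≤ r → r ≤ r0 → 0 < u r) (hE : energy Φ u p r0 < 0) :
    ∀ r, 0 ≤ r → 0 < u r := by
  intro r hr
  by_contra! hcon
  have hrr : r0 ≤ r := by
    by_contra! h1
    linarith [hpos r hr h1.le]
  obtain ⟨c, hc1, -, hc2, -⟩ := exists_first_zero hrr
    (h.cont_u.mono fun x hx => hr0.trans hx.1) (hpos r0 hr0 le_rfl) hcon
  have h1 := antitoneOn_energy hF h hr0 (hr0.trans hc1.le) hc1.le
  rw [energy, hc2, hF.Φ_zero] at h1
  nlinarith [sq_nonneg (p c)]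

/-- The initial values `y` whose solution `U y` becomes negative. -/
def crossingSet (U : ℝ → ℝ → ℝ) : Set ℝ := {y | ∃ r, 0 ≤ r ∧ U y r < 0}

/-- The initial values `y` whose solution `U y`, with derivative `P y`, stays positive and reaches
a negative energy. -/
def trappedSet (Φ : ℝ → ℝ) (U P : ℝ → ℝ → ℝ) : Set ℝ :=
  {y | (∀ r, 0 ≤ r → 0 < U y r) ∧ ∃ r, 0 ≤ r ∧ energy Φ (U y) (P y) r < 0}

lemma shooting_trichotomy (hF : GroundStateNonlinearity F F' Φ B L M)
    (hU : ∀ y, RadialSolution n (fun _ x => F x) (U y) (P y) ∧ U y 0 = y) {y : ℝ} (hy : 0 < y)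
    (hyB : y < B) :
    y ∈ crossingSet U ∨ y ∈ trappedSet Φ U P ∨ GroundState n F B (U y) (P y) := by
  by_cases h1 : y ∈ crossingSet U
  · exact Or.inl h1
  have hnn : ∀ r, 0 ≤ r → 0 ≤ U y r := by
    intro r hr
    by_contra! h
    exact h1 ⟨r, hr, h⟩
  obtain ⟨hs, h0⟩ := hU y
  by_cases h2 : ∀ r, 0 ≤ r → 0 ≤ energy Φ (U y) (P y) r
  · exact Or.inr (Or.inr (groundState_of_nonneg hF hs (by rwa [h0]) (by rwa [h0]) hnn h2))
  · push Not at h2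
    exact Or.inr (Or.inl ⟨u_pos_of_nonneg hF hs (by rwa [h0]) hnn, h2⟩)

lemma disjoint_crossing_trapped {y : ℝ} (h1 : y ∈ crossingSet U)
    (h2 : y ∈ trappedSet Φ U P) : False := by
  obtain ⟨r, hr, h⟩ := h1
  linarith [h2.1 r hr]

lemma shooting_lipschitz (hF : GroundStateNonlinearity F F' Φ B L M)
    (hU : ∀ y, RadialSolution n (fun _ x => F x) (U y) (P y) ∧ U y 0 = y) {R : ℝ} :
    ∃ K, 0 < K ∧ ∀ r, 0 ≤ r → r ≤ R → ∀ y z, |U y r - U z r| ≤ K * |y - z| ∧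
      |P y r - P z r| ≤ K * |y - z| := by
  have hL := hF.L_nonneg
  refine ⟨1 + L * Real.exp ((2 + L) * R), by positivity, fun r hr hrR y z => ?_⟩
  have h := (hU y).1.abs_sub_le hL (fun _ _ => hF.abs_F_sub_le) (hU z).1 hr
  rw [(hU y).2, (hU z).2] at h
  have hK : (1 + L * Real.exp ((2 + L) * r)) * |y - z| ≤
      (1 + L * Real.exp ((2 + L) * R)) * |y - z| := by gcongr
  exact ⟨h.1.trans hK, h.2.trans hK⟩

lemma continuous_of_lipschitz {f : ℝ → ℝ} {K : ℝ} (hK : 0 < K)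
    (hf : ∀ y z, |f y - f z| ≤ K * |y - z|) : Continuous f :=
  (LipschitzWith.of_dist_le_mul (K := ⟨K, hK.le⟩) fun x y => by
    rw [Real.dist_eq, Real.dist_eq]; exact hf x y).continuous

lemma continuous_shooting (hF : GroundStateNonlinearity F F' Φ B L M)
    (hU : ∀ y, RadialSolution n (fun _ x => F x) (U y) (P y) ∧ U y 0 = y) {r : ℝ} (hr : 0 ≤ r) :
    Continuous (fun y => U y r) ∧ Continuous (fun y => energy Φ (U y) (P y) r) := by
  obtain ⟨K, hK, h⟩ := shooting_lipschitz hF hU (R := r)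
  have h1 : Continuous fun y => U y r :=
    continuous_of_lipschitz hK fun y z => (h r hr le_rfl y z).1
  have h2 : Continuous fun y => P y r :=
    continuous_of_lipschitz hK fun y z => (h r hr le_rfl y z).2
  exact ⟨h1, ((h2.pow 2).div_const 2).add (hF.continuous_Φ.comp h1)⟩

lemma isOpen_crossingSet (hF : GroundStateNonlinearity F F' Φ B L M)
    (hU : ∀ y, RadialSolution n (fun _ x => F x) (U y) (P y) ∧ U y 0 = y) :
    IsOpen (crossingSet U) := by
  rw [isOpen_iff_mem_nhds]
  rintro y ⟨r, hr, h⟩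
  filter_upwards [(continuous_shooting hF hU hr).1.continuousAt.eventually_lt_const h] with z hz
  exact ⟨r, hr, hz⟩

lemma isOpen_trappedSet (hF : GroundStateNonlinearity F F' Φ B L M)
    (hU : ∀ y, RadialSolution n (fun _ x => F x) (U y) (P y) ∧ U y 0 = y) :
    IsOpen (trappedSet Φ U P) := by
  rw [isOpen_iff_mem_nhds]
  rintro y ⟨hpos, r, hr, hE⟩
  obtain ⟨K, hK, hlip⟩ := shooting_lipschitz hF hU (R := r)
  obtain ⟨x, hx, hmin⟩ := isCompact_Icc.exists_isMinOn (nonempty_Icc.2 hr)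
    ((hU y).1.cont_u.mono fun t ht => ht.1)
  have hμ := hpos x hx.1
  have hball : ∀ᶠ z in 𝓝 y, |z - y| < U y x / K := by
    have := Metric.ball_mem_nhds y (div_pos hμ hK)
    filter_upwards [this] with z hz
    rwa [Metric.mem_ball, Real.dist_eq] at hz
  filter_upwards [(continuous_shooting hF hU hr).2.continuousAt.eventually_lt_const hE, hball]
    with z hz1 hz2
  refine ⟨pos_of_energy_neg hF (hU z).1 hr (fun t h1 h2 => ?_) hz1, r, hr, hz1⟩
  have h3 := (abs_le.1 (hlip t h1 h2 z y).1).1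
  have h4 : U y x ≤ U y t := hmin ⟨h1, h2⟩
  rw [lt_div_iff₀ hK] at hz2
  linarith

lemma TendsToNegInftyExponentially.eventually_lt {f : ℝ → ℝ}
    (hf : TendsToNegInftyExponentially f) (c : ℝ) : ∀ᶠ r in atTop, f r < c := by
  obtain ⟨C, hC, κ, hκ, h⟩ := hf
  have h1 : Tendsto (fun r : ℝ => C * Real.exp (κ * r)) atTop atTop :=
    (Real.tendsto_exp_atTop.comp (tendsto_id.const_mul_atTop hκ)).const_mul_atTop hC
  filter_upwards [h, h1.eventually_gt_atTop (-c)] with r h2 h3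
  linarith

/-- Since the linearized solution diverges to `-∞`, slightly larger initial values than that of
a ground state give solutions crossing zero, and slightly smaller ones give trapped solutions. -/
lemma shooting_near_groundState (hF : GroundStateNonlinearity F F' Φ B L M)
    (hU : ∀ y, RadialSolution n (fun _ x => F x) (U y) (P y) ∧ U y 0 = y) {y : ℝ}
    (g : GroundState n F B (U y) (P y)) :
    ∃ ε, 0 < ε ∧ (∀ z, y < z → z < y + ε → z ∈ crossingSet U) ∧
      ∀ z, y - ε < z → z < y → z ∈ trappedSet Φ U P := by
  obtain ⟨v, q, hv, hv0⟩ := exists_linearized hF g.sol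
  obtain ⟨hvexp, hqexp⟩ := linearized_exponential hF g hv hv0
  obtain ⟨δ, m, hδ, -, hm, hF'⟩ := hF.exists_F'_le
  obtain ⟨R, ⟨hvR, hqR⟩, hR, huR⟩ := (((hvexp.eventually_lt (-1)).and
    (hqexp.eventually_lt (-1))).and ((eventually_gt_atTop 0).and
      (g.tendsto_u.eventually_lt_const (half_pos hδ)))).exists
  obtain ⟨K, hK, hlip⟩ := shooting_lipschitz hF hU (R := R)
  obtain ⟨D, hD, hDer⟩ := abs_sub_linearized_le hF g.sol hv hv0 hR.le
  have hanti := g.strictAntiOn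
  have hUR := g.pos R hR.le
  have hy0 : 0 < y := by have := g.pos 0 le_rfl; rwa [(hU y).2] at this
  have hyB : y < B := by have := g.zero_lt; rwa [(hU y).2] at this
  obtain ⟨ε, hε, hε1, hε2, hε3, hε4⟩ : ∃ ε, 0 < ε ∧ D * ε ≤ 1 / 2 ∧ K * ε ≤ δ / 2 ∧
      K * ε ≤ U y R ∧ ε ≤ y := by
    have h1 : 0 < min (1 / 2 / (D + 1)) (min (δ / 2 / K) (min (U y R / K) y)) := by positivity
    refine ⟨_, h1, ?_, ?_, ?_, ?_⟩
    · have h2 : min (1 / 2 / (D + 1)) (min (δ / 2 / K) (min (U y R / K) y)) ≤ 1 / 2 / (D + 1) :=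
        min_le_left _ _
      rw [le_div_iff₀ (by positivity)] at h2
      linarith
    · rw [mul_comm, ← le_div_iff₀ hK]
      exact (min_le_right _ _).trans (min_le_left _ _)
    · rw [mul_comm, ← le_div_iff₀ hK]
      exact (min_le_right _ _).trans ((min_le_right _ _).trans (min_le_left _ _))
    · exact (min_le_right _ _).trans ((min_le_right _ _).trans (min_le_right _ _))
  refine ⟨ε, hε, fun z hyz hzε => ?_, fun z hzε hzy => ?_⟩
  · have hd := hDer (hU z).1
    rw [(hU z).2, (hU y).2] at hd
    have hh : 0 < z - y := by linarith
    have hsq : D * (z - y) ^ 2 ≤ (z - y) / 2 := by nlinarith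
    have h1 : U z R < U y R := by
      have := (abs_le.1 hd.1).2
      nlinarith
    have h2 : P z R < P y R := by
      have := (abs_le.1 hd.2).2
      nlinarith
    by_contra hcon
    have hnn : ∀ r, 0 ≤ r → 0 ≤ U z r := by
      intro r hr
      by_contra! h
      exact hcon ⟨r, hr, h⟩
    obtain ⟨T, hT1, hT2⟩ := ((g.tendsto_u.eventually_lt_const (sub_pos.2 h1)).and
      (eventually_ge_atTop R)).exists
    have h3 := sub_ge_of_le hF (hU z).1 g.sol hm hF' hR h1 h2
      (fun r hr _ => by linarith [hnn r (hR.le.trans hr)])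
      (fun r hr _ => by
        have := hanti.antitoneOn hR.le (hR.le.trans hr) hr
        linarith) hT2
    linarith [hnn T (hR.le.trans hT2)]
  · have hd := hDer (hU z).1
    rw [(hU z).2, (hU y).2] at hd
    have hh : 0 < y - z := by linarith
    have hsq : D * (z - y) ^ 2 ≤ (y - z) / 2 := by nlinarith
    have h1 : U y R < U z R := by
      have := (abs_le.1 hd.1).1
      nlinarith
    have h2 : P y R < P z R := by
      have := (abs_le.1 hd.2).1
      nlinarith
    have hzK : K * |z - y| < K * ε := by
      rw [abs_of_neg (by linarith)]
      exact mul_lt_mul_of_pos_left (by linarith) hK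
    have hzR : U z R < δ := by
      have := (abs_le.1 (hlip R hR.le le_rfl z y).1).2
      linarith
    -- A time at which `U z ≤ U y` contradicts the growth of the difference.
    have key : ∀ T, R ≤ T → AntitoneOn (U z) (Icc R T) → U y R - U z R < U y T - U z T → False := by
      intro T hT hzanti hlt
      have := sub_ge_of_le hF g.sol (hU z).1 hm hF' hR h1 h2
        (fun r hr _ => by linarith [g.pos r (hR.le.trans hr)])
        (fun r hr hrT => (hzanti ⟨le_rfl, hT⟩ ⟨hr, hrT⟩ hr).trans hzR.le) hT
      linarith
    rcases shooting_trichotomy hF hU (show 0 < z by linarith) (by linarith) with h | h | h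
    · exfalso
      obtain ⟨r, hr, hUr⟩ := h
      obtain ⟨c, hc, -, hUc, hUpos⟩ := exists_first_zero hr
        ((hU z).1.cont_u.mono fun x hx => hx.1) (by rw [(hU z).2]; linarith) hUr.le
      have hRc : R < c := by
        by_contra! hcR
        have h3 := (abs_le.1 (hlip c hc.le hcR z y).1).1
        have h4 := hanti.antitoneOn hc.le hR.le hcR
        linarith
      have hEc : 0 ≤ energy Φ (U z) (P z) c := by
        rw [energy, hUc, hF.Φ_zero]; positivity
      have hneg := deriv_neg_of_energy_nonneg hF (hU z).1 (by rw [(hU z).2]; linarith) hUpos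
        fun t h3 h4 => hEc.trans (antitoneOn_energy hF (hU z).1 h3 hc.le h4.le)
      refine key c hRc.le ?_ (by rw [hUc]; linarith [g.pos c hc.le])
      refine antitoneOn_of_hasDerivWithinAt_nonpos (convex_Icc R c) (f' := P z)
        ((hU z).1.cont_u.mono fun x hx => hR.le.trans hx.1) (fun t ht => ?_) (fun t ht => ?_) <;>
        rw [interior_Icc] at ht
      · exact ((hU z).1.hasDerivAt_u t (hR.trans ht.1)).hasDerivWithinAt
      · exact (hneg t (hR.trans ht.1) ht.2).le
    · exact h
    · exfalso
      obtain ⟨T, hT1, hT2⟩ := ((h.tendsto_u.eventually_lt_const (sub_pos.2 h1)).and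
        (eventually_ge_atTop R)).exists
      refine key T hT2 (h.strictAntiOn.antitoneOn.mono fun x hx => hR.le.trans hx.1) ?_
      linarith [g.pos T (hR.le.trans hT2)]

/-! ### Uniqueness and existence of the ground state -/

lemma not_groundState_lt (hF : GroundStateNonlinearity F F' Φ B L M)
    (hU : ∀ y, RadialSolution n (fun _ x => F x) (U y) (P y) ∧ U y 0 = y) {y z : ℝ}
    (gy : GroundState n F B (U y) (P y)) (gz : GroundState n F B (U z) (P z)) : ¬ y < z := by
  intro hyz
  have hy0 : 0 < y := by have := gy.pos 0 le_rfl; rwa [(hU y).2] at this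
  have hzB : z < B := by have := gz.zero_lt; rwa [(hU z).2] at this
  have hz : z ∉ crossingSet U := by
    rintro ⟨r, hr, h⟩
    linarith [gz.pos r hr]
  obtain ⟨ε, hε, hcross, -⟩ := shooting_near_groundState hF hU gy
  -- The first initial value above `y` whose solution does not cross zero.
  set S := Icc (y + ε / 2) z ∩ (crossingSet U)ᶜ with hS
  have hzε : y + ε ≤ z := by
    by_contra! h
    exact hz (hcross z hyz h)
  have hSne : S.Nonempty := ⟨z, ⟨by linarith, le_rfl⟩, hz⟩
  have hScl : IsClosed S := isClosed_Icc.inter (isOpen_crossingSet hF hU).isClosed_compl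
  have hSbdd : BddBelow S := ⟨y + ε / 2, fun x hx => hx.1.1⟩
  obtain ⟨⟨hs1, hs2⟩, hs3⟩ := hScl.csInf_mem hSne hSbdd
  set s := sInf S with hs
  have hbelow : ∀ t, y < t → t < s → t ∈ crossingSet U := by
    intro t h1 h2
    by_contra hcon
    rcases lt_or_ge t (y + ε) with h3 | h3
    · exact hcon (hcross t h1 h3)
    · have : s ≤ t := csInf_le hSbdd ⟨⟨by linarith, by linarith⟩, hcon⟩
      linarith
  have hys : y < s := by linarith
  rcases shooting_trichotomy hF hU (hy0.trans hys) (hs2.trans_lt hzB) with h | h | h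
  · exact hs3 h
  · have h1 : ∀ᶠ t in 𝓝[<] s, t ∈ trappedSet Φ U P :=
      nhdsWithin_le_nhds ((isOpen_trappedSet hF hU).mem_nhds h)
    obtain ⟨t, h2, h3⟩ := (h1.and (Ioo_mem_nhdsLT hys)).exists
    exact disjoint_crossing_trapped (hbelow t h3.1 h3.2) h2
  · obtain ⟨ε', hε', -, htrap⟩ := shooting_near_groundState hF hU h
    obtain ⟨t, h1, h2⟩ := exists_between (max_lt hys (show s - ε' < s by linarith))
    rw [max_lt_iff] at h1
    exact disjoint_crossing_trapped (hbelow t h1.1 h2) (htrap t h1.2 h2)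

/-- Solutions starting close to the equilibrium `B` stay close to it for a long time, after
which the damping is too weak to dissipate their energy before they cross zero. -/
lemma exists_crossing (hF : GroundStateNonlinearity F F' Φ B L M)
    (hU : ∀ y, RadialSolution n (fun _ x => F x) (U y) (P y) ∧ U y 0 = y) :
    ∃ y, 0 < y ∧ y < B ∧ y ∈ crossingSet U := by
  have hB := hF.B_pos
  have hΦB := hF.Φ_B_pos
  have hL := hF.L_nonneg
  set C := Real.sqrt (2 * (Φ B + L * B * B)) with hC
  have hC2 : C ^ 2 = 2 * (Φ B + L * B * B) := Real.sq_sqrt (by positivity)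
  have hC0 : 0 ≤ C := Real.sqrt_nonneg _
  obtain ⟨R, hR, hRC⟩ : ∃ R : ℝ, 0 < R ∧ n * C / R * B ≤ Φ B / 4 := by
    refine ⟨n * C * B * 4 / Φ B + 1, by positivity, ?_⟩
    rw [div_mul_eq_mul_div, div_le_iff₀ (by positivity)]
    have : Φ B / 4 * (n * C * B * 4 / Φ B + 1) = n * C * B + Φ B / 4 := by
      field_simp
    linarith
  have hconst : U B R = B := by
    have hc : RadialSolution n (fun _ x => F x) (fun _ => B) (fun _ => 0) :=
      ⟨continuousOn_const, continuousOn_const, rfl, fun r _ => hasDerivAt_const r _,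
        fun r _ => by simpa [hF.F_eq_zero_of_Φ_eq le_rfl] using hasDerivAt_const r (0 : ℝ)⟩
    exact (hU B).1.unique_nonlin hF hc (hU B).2 hR.le
  have hcont : Continuous fun y => Φ (U y R) :=
    hF.continuous_Φ.comp (continuous_shooting hF hU hR.le).1
  have hev : ∀ᶠ y in 𝓝[<] B, Φ B / 2 < Φ (U y R) :=
    nhdsWithin_le_nhds (hcont.continuousAt.eventually_const_lt (by simp only [hconst]; linarith))
  obtain ⟨y, hyΦ, hy0, hyB⟩ := (hev.and (Ioo_mem_nhdsLT hB)).exists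
  refine ⟨y, hy0, hyB, ?_⟩
  by_contra hcon
  obtain ⟨hs, h0⟩ := hU y
  have hnn : ∀ r, 0 ≤ r → 0 ≤ U y r := by
    intro r hr
    by_contra! h
    exact hcon ⟨r, hr, h⟩
  have hpos := u_pos_of_nonneg hF hs (by rwa [h0]) hnn
  set E := energy Φ (U y) (P y) with hE
  have hEanti : AntitoneOn E (Ici 0) := antitoneOn_energy hF hs
  have hER : Φ B / 2 < E R := by
    simp only [hE, energy]
    nlinarith [sq_nonneg (P y R)]
  have hlow : ∀ T, R < T → (∀ r, 0 ≤ r → r < T → 0 ≤ E r) → Φ B / 4 ≤ E T := by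
    intro T hRT hEnn
    have hneg := deriv_neg_of_energy_nonneg hF hs (by rwa [h0]) (fun r hr _ => hpos r hr) hEnn
    have hUanti : AntitoneOn (U y) (Icc 0 T) := by
      refine antitoneOn_of_hasDerivWithinAt_nonpos (convex_Icc 0 T) (f' := P y)
        (hs.cont_u.mono fun x hx => hx.1) (fun t ht => ?_) (fun t ht => ?_) <;>
        rw [interior_Icc] at ht
      · exact (hs.hasDerivAt_u t ht.1).hasDerivWithinAt
      · exact (hneg t ht.1 ht.2).le
    have hUB : ∀ r, 0 ≤ r → r ≤ T → U y r ≤ B := by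
      intro r h1 h2
      have := hUanti ⟨le_rfl, h1.trans h2⟩ ⟨h1, h2⟩ h1
      rw [h0] at this
      linarith
    have hmono : MonotoneOn (fun r => E r - n * C / R * U y r) (Icc R T) := by
      refine monotoneOn_of_hasDerivWithinAt_nonneg (convex_Icc R T)
        (f' := fun r => -(n / r * P y r ^ 2) - n * C / R * P y r)
        (((continuousOn_energy hF hs).sub (continuousOn_const.mul hs.cont_u)).mono
          fun x hx => hR.le.trans hx.1) (fun t ht => ?_) (fun t ht => ?_) <;>
        rw [interior_Icc] at ht <;> have ht0 : 0 < t := hR.trans ht.1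
      · exact ((hasDerivAt_energy hF hs ht0).sub
          ((hs.hasDerivAt_u t ht0).const_mul _)).hasDerivWithinAt
      · have h1 := hneg t ht0 ht.2
        have h2 : P y t ^ 2 ≤ C ^ 2 := by
          have h3 : E t ≤ E 0 := hEanti self_mem_Ici ht0.le ht0.le
          have h4 : E 0 ≤ Φ B := by
            simp only [hE, energy, hs.p_zero, h0]
            linarith [hF.Φ_le y]
          have h5 := hF.abs_Φ_le (hpos t ht0.le).le
          have h6 : L * U y t * U y t ≤ L * B * B := by
            have := hUB t ht0.le ht.2.le
            have := hpos t ht0.le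
            gcongr
          have h7 := (abs_le.1 h5).1
          have h8 : E t = P y t ^ 2 / 2 + Φ (U y t) := rfl
          linarith
        have h3 : -P y t ≤ C := by nlinarith
        have h4 : P y t ^ 2 ≤ C * -P y t := by nlinarith
        have h5 : n / t * P y t ^ 2 ≤ n / R * (C * -P y t) := by
          have := ht.1.le
          gcongr
        have h6 : n / R * (C * -P y t) = -(n * C / R * P y t) := by ring
        linarith
    have h1 := hmono ⟨le_rfl, hRT.le⟩ ⟨hRT.le, le_rfl⟩ hRT.le
    simp only at h1
    have h2 : n * C / R * U y R ≤ n * C / R * B := by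
      have := hUB R hR.le hRT.le
      gcongr
    have h3 : 0 ≤ n * C / R * U y T := by
      have := hpos T (hR.trans hRT).le
      positivity
    linarith
  have hEnn : ∀ r, 0 ≤ r → 0 ≤ E r := by
    intro r hr
    by_contra! hneg
    have h1 : 0 < E 0 := by linarith [hEanti self_mem_Ici hR.le hR.le]
    obtain ⟨T, hT0, -, hET, hEpos⟩ := exists_first_zero hr
      ((continuousOn_energy hF hs).mono fun x hx => hx.1) h1 hneg.le
    have hRT : R < T := by
      by_contra! h
      have := hEanti hT0.le hR.le h
      linarith
    have := hlow T hRT fun t h2 h3 => (hEpos t h2 h3).le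
    have hET' : E T = 0 := hET
    linarith
  have g := groundState_of_nonneg hF hs (by rwa [h0]) (by rwa [h0]) hnn hEnn
  obtain ⟨T, h1, h2⟩ := (((tendsto_energy hF g.tendsto_u g.tendsto_p).eventually_lt_const
    (show 0 < Φ B / 4 by linarith)).and (eventually_gt_atTop R)).exists
  have := hlow T h2 fun r hr _ => hEnn r hr
  linarith

lemma exists_groundState (hF : GroundStateNonlinearity F F' Φ B L M)
    (hU : ∀ y, RadialSolution n (fun _ x => F x) (U y) (P y) ∧ U y 0 = y) :
    ∃ y, GroundState n F B (U y) (P y) := by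
  by_contra! hcon
  obtain ⟨y, hy0, hyB, hy⟩ := exists_crossing hF hU
  obtain ⟨z, hz0, hzB, hz⟩ := hF.exists_Φ_neg
  have hEz : energy Φ (U z) (P z) 0 < 0 := by
    simpa [energy, (hU z).1.p_zero, (hU z).2] using hz
  have hzt : z ∈ trappedSet Φ U P := by
    refine ⟨pos_of_energy_neg hF (hU z).1 le_rfl (fun r h1 h2 => ?_) hEz, 0, le_rfl, hEz⟩
    rw [le_antisymm h2 h1, (hU z).2]
    exact hz0
  obtain ⟨x, -, hx1, hx2⟩ := isPreconnected_Ioo (a := 0) (b := B) _ _ (isOpen_crossingSet hF hU)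
    (isOpen_trappedSet hF hU) (fun x hx => by
      rcases shooting_trichotomy hF hU hx.1 hx.2 with h | h | h
      · exact Or.inl h
      · exact Or.inr h
      · exact absurd h (hcon x)) ⟨y, ⟨hy0, hyB⟩, hy⟩ ⟨z, ⟨hz0, hzB⟩, hzt⟩
  exact disjoint_crossing_trapped hx1 hx2

lemma GroundState.unique (hF : GroundStateNonlinearity F F' Φ B L M) {u p u' p' : ℝ → ℝ}
    (g : GroundState n F B u p) (g' : GroundState n F B u' p') : EqOn u u' (Ici 0) := by
  obtain ⟨U, P, hU⟩ := exists_shooting hF n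
  have hshoot : ∀ {u p : ℝ → ℝ}, GroundState n F B u p →
      GroundState n F B (U (u 0)) (P (u 0)) := by
    intro u p g
    have he : ∀ r, 0 ≤ r → U (u 0) r = u r ∧ P (u 0) r = p r := by
      intro r hr
      have := (hU (u 0)).1.abs_sub_le hF.L_nonneg (fun _ _ => hF.abs_F_sub_le) g.sol hr
      rw [(hU (u 0)).2, sub_self, abs_zero, mul_zero] at this
      exact ⟨sub_eq_zero.1 (abs_nonpos_iff.1 this.1), sub_eq_zero.1 (abs_nonpos_iff.1 this.2)⟩
    refine groundState_of_pos hF (hU (u 0)).1 (fun r hr => (he r hr).1 ▸ g.pos r hr)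
      (g.tendsto_u.congr' ?_) (g.tendsto_p.congr' ?_) <;>
      filter_upwards [eventually_ge_atTop 0] with r hr
    · exact (he r hr).1.symm
    · exact (he r hr).2.symm
  refine g.sol.unique_nonlin hF g'.sol ?_
  rcases lt_trichotomy (u 0) (u' 0) with h | h | h
  · exact absurd h (not_groundState_lt hF hU (hshoot g) (hshoot g'))
  · exact h
  · exact absurd h (not_groundState_lt hF hU (hshoot g') (hshoot g))

end Shooting

/-! ### The sine nonlinearity -/

lemma deriv_nonlinF (a b x : ℝ) : deriv (nonlinF a b) x = nonlinF' a b x :=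
  (hasDerivAt_nonlinF a b x).deriv

lemma TendsToNegInftyExponentially.congr' {f g : ℝ → ℝ} (hf : TendsToNegInftyExponentially f)
    (hfg : f =ᶠ[atTop] g) : TendsToNegInftyExponentially g := by
  obtain ⟨C, hC, κ, hκ, h⟩ := hf
  refine ⟨C, hC, κ, hκ, ?_⟩
  filter_upwards [h, hfg] with r h1 h2
  rwa [← h2]

lemma TendsToNegInftyExponentially.divergesExponentially {f : ℝ → ℝ}
    (hf : TendsToNegInftyExponentially f) : DivergesExponentially f := by
  obtain ⟨C, hC, κ, hκ, h⟩ := hf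
  refine ⟨C, hC, κ, hκ, ?_⟩
  filter_upwards [h] with r h1
  linarith [neg_le_abs (f r)]

theorem theorem6 (a b : ℝ) (hb : 0 < b) (hab : 2 * b < a) (d : ℕ) (hd : 1 ≤ d) :
    ∃ Q : ℝ → ℝ, IsRadialGroundState d a b Q ∧
      (∀ u : ℝ → ℝ, IsRadialGroundState d a b u → EqOn u Q (Ici 0)) ∧
      ∃ v : ℝ → ℝ, IsLinearizedSolution d a b Q v ∧
        (∀ w : ℝ → ℝ, IsLinearizedSolution d a b Q w → EqOn w v (Ici 0)) ∧
        DivergesExponentially v ∧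
        (2 ≤ d → TendsToNegInftyExponentially v ∧
          TendsToNegInftyExponentially (radDeriv v)) := by
  obtain ⟨n, rfl⟩ : ∃ n, d = n + 1 := ⟨d - 1, by omega⟩
  have hF := groundStateNonlinearity_nonlinF hb hab
  obtain ⟨U, P, hU⟩ := exists_shooting hF n
  obtain ⟨y, g⟩ := exists_groundState hF hU
  obtain ⟨v, q, hv, hv0⟩ := exists_linearized hF g.sol
  obtain ⟨hvexp, hqexp⟩ := linearized_exponential hF g hv hv0
  have hderiv : ∀ {f f' : ℝ → ℝ} {G : ℝ → ℝ → ℝ}, RadialSolution n G f f' →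
      f' =ᶠ[atTop] radDeriv f := by
    intro f f' G h
    filter_upwards [eventually_ge_atTop 0] with r hr using (h.radDeriv_eq hr).symm
  refine ⟨U y, ⟨g.sol.solvesRadialODE, g.pos,
    g.tendsto_u.prodMk_nhds (g.tendsto_p.congr' (hderiv g.sol))⟩, ?_, v, ⟨?_, hv0⟩, ?_,
    hvexp.divergesExponentially, fun _ => ⟨hvexp, hqexp.congr' (hderiv hv)⟩⟩
  · rintro u ⟨hu, hupos, hulim⟩
    rw [nhds_prod_eq, tendsto_prod_iff'] at hulim
    exact (groundState_of_pos hF hu.radialSolution hupos hulim.1 hulim.2).unique hF g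
  · simp only [deriv_nonlinF]
    exact hv.solvesRadialODE
  · rintro w ⟨hw, hw0⟩
    simp only [deriv_nonlinF] at hw
    refine hw.radialSolution.unique hF.L_nonneg (fun r _ s t => ?_) hv (hw0.trans hv0.symm)
    rw [← mul_sub, abs_mul]
    exact mul_le_mul_of_nonneg_right (hF.abs_F'_le _) (abs_nonneg _)
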